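/- Let $d\ge 1$ be an integer, $R>0$, let $B_R\subset\mathbb{R}^d$ be the open ball of radius $R$ centred at $0$, and let $|E|$ denote the Lebesgue measure of a set $E\subset\mathbb{R}^d$. Let $u\in H^1(B_R)$ be real-valued, i.e. $u\in L^2(B_R)$ has a weak gradient $\nabla u\in L^2(B_R;\mathbb{R}^d)$. Then for all $(k,l)\in\mathbb{R}^2$ with $k\le l$, the function $(u-k)_+=\max(u-k,0)$ belongs to $H^1(B_R)$, and its weak gradient $\nabla(u-k)_+$ satisfies $$(l-k)\,\big|\{u\le k\}\cap B_R\big|\,\big|\{u\ge l\}\cap B_R\big|\;\le\; R\,|B_R|\,\big|\{k<u<l\}\cap B_R\big|^{1/2}\,\Big(\int_{B_R}|\nabla(u-k)_+(x)|^2\,\mathrm{d}x\Big)^{1/2}.$$ -/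

import Mathlib

open MeasureTheory
open scoped ContDiff

/-- `G` is a weak gradient of `u` on the open set `Ω`: both are locally integrable on `Ω` and
`∫_Ω u ∂ᵢφ = - ∫_Ω Gᵢ φ` for all test functions `φ ∈ C_c^∞(Ω)` and all coordinates `i`. -/
def HasWeakGradientOn {d : ℕ} (u : EuclideanSpace ℝ (Fin d) → ℝ)
    (G : EuclideanSpace ℝ (Fin d) → EuclideanSpace ℝ (Fin d))
    (Ω : Set (EuclideanSpace ℝ (Fin d))) : Prop :=
  LocallyIntegrableOn u Ω volume ∧ LocallyIntegrableOn G Ω volume ∧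
    ∀ φ : EuclideanSpace ℝ (Fin d) → ℝ,
      ContDiff ℝ ∞ φ → HasCompactSupport φ → tsupport φ ⊆ Ω →
        ∀ i : Fin d,
          ∫ x in Ω, u x * fderiv ℝ φ x (EuclideanSpace.single i 1) =
            -∫ x in Ω, G x i * φ x

/-- `u` (a representative) belongs to the Sobolev space `H¹(Ω)`: `u ∈ L²(Ω)` and `u` has a
weak gradient on `Ω` that is in `L²(Ω)`. -/
def MemH1 {d : ℕ} (u : EuclideanSpace ℝ (Fin d) → ℝ)
    (Ω : Set (EuclideanSpace ℝ (Fin d))) : Prop :=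
  MemLp u 2 (volume.restrict Ω) ∧
    ∃ G : EuclideanSpace ℝ (Fin d) → EuclideanSpace ℝ (Fin d),
      HasWeakGradientOn u G Ω ∧ MemLp G 2 (volume.restrict Ω)

/-! Truncated at heights `0` and `l - k`, the function `w = (u - k)_+` is constant on `{u ≤ k}` and
on `{u ≥ l}`, and its gradient lives on `{k < u < l}`. Pairs of points with one in each of these two
sets, taken in both orders, contribute `2 (l - k) |{u ≤ k}| |{u ≥ l}|` to the double integral of `|w
y - w x|` over `B × B`. The estimate therefore follows from the `L¹` Poincaré inequality with
constant `2 R |B|` (`lintegral_ball_enorm_sub_le`), and Cauchy–Schwarz on `{k < u < l}` then gives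
the `L²` form.

The Poincaré constant must not depend on the dimension. By Archimedes' principle, the uniform law on
a sphere of `E × ℂ`, which has two more dimensions than `E`, projects to the uniform law on a ball
of `E`. Hence `ballProj R` sends a standard Gaussian on `E × ℂ` to the uniform law on the ball
(`lintegral_comp_ballProj`). As in the Maurey–Pisier argument, two independent Gaussian vectors `z,
w` are joined by `cos t • z + sin t • w`, `0 ≤ t ≤ π / 2`. At each time the position and the
velocity are again independent Gaussians. The velocity is averaged by a first moment bound, and the
position contributes the mean of `1 / ‖z‖`. The resulting constant is below `2 R`.

Passage from `C¹` to weakly differentiable functions is by mollification on smaller balls.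
Truncations are limits of primitives of continuous functions with values in `[0, 1]`, for which the
chain rule is elementary. -/

/-! ### Radial integrals and the projection of `E × ℂ` onto a ball. -/

open Set Real ENNReal in
/-- Integrals over the plane of functions of the squared modulus. -/
theorem Complex.lintegral_comp_norm_sq {h : ℝ → ℝ≥0∞} (hh : Measurable h) :
    ∫⁻ q : ℂ, h (‖q‖ ^ 2) = ENNReal.ofReal π * ∫⁻ s in Ioi (0 : ℝ), h s := by
  have himg : (fun r : ℝ => r ^ 2) '' Ioi 0 = Ioi 0 := by
    ext s
    constructor
    · rintro ⟨r, hr, rfl⟩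
      exact pow_pos (mem_Ioi.1 hr) 2
    · intro hs
      exact ⟨√s, Real.sqrt_pos.2 hs, Real.sq_sqrt (le_of_lt hs)⟩
  have hsub : ∫⁻ s in Ioi (0 : ℝ), h s
      = ∫⁻ r in Ioi (0 : ℝ), ENNReal.ofReal |2 * r| * h (r ^ 2) := by
    conv_lhs => rw [← himg]
    refine lintegral_image_eq_lintegral_abs_deriv_mul measurableSet_Ioi
      (f := fun r : ℝ => r ^ 2) (f' := fun r => 2 * r) (fun x _ => ?_) ?_ h
    · simpa using ((hasDerivAt_pow 2 x).hasDerivWithinAt)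
    · intro a ha b hb hab
      exact (pow_left_inj₀ (le_of_lt ha) (le_of_lt hb) two_ne_zero).1 hab
  rw [← Complex.lintegral_comp_polarCoord_symm]
  have h1 : ∀ p ∈ polarCoord.target,
      ENNReal.ofReal p.1 • h (‖Complex.polarCoord.symm p‖ ^ 2)
        = ENNReal.ofReal p.1 * h (p.1 ^ 2) := by
    intro p _
    rw [Complex.norm_polarCoord_symm, sq_abs, smul_eq_mul]
  rw [setLIntegral_congr_fun polarCoord.open_target.measurableSet h1, polarCoord_target,
    Measure.volume_eq_prod, ← Measure.prod_restrict, lintegral_prod _ (by fun_prop)]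
  simp only [lintegral_const, Measure.restrict_apply MeasurableSet.univ, univ_inter,
    Real.volume_Ioo, show π - -π = 2 * π by ring]
  rw [hsub, lintegral_mul_const _ (by fun_prop), mul_comm, ← lintegral_const_mul _ (by fun_prop),
    ← lintegral_const_mul _ (by fun_prop)]
  refine setLIntegral_congr_fun measurableSet_Ioi fun r hr => ?_
  have hr' : 0 < r := hr
  rw [abs_of_pos (by positivity), ← mul_assoc, ← mul_assoc, ← ENNReal.ofReal_mul (by positivity),
    ← ENNReal.ofReal_mul (by positivity)]
  congr 2
  ring

section Gaussian

variable {E : Type*} [NormedAddCommGroup E]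

/-- The squared Euclidean norm on `E × ℂ`. -/
noncomputable def prodSqNorm (z : E × ℂ) : ℝ := ‖z.1‖ ^ 2 + ‖z.2‖ ^ 2

@[fun_prop]
theorem continuous_prodSqNorm : Continuous (prodSqNorm : E × ℂ → ℝ) := by
  unfold prodSqNorm; fun_prop

theorem measurable_prodSqNorm [MeasurableSpace E] [BorelSpace E] :
    Measurable (prodSqNorm : E × ℂ → ℝ) :=
  continuous_prodSqNorm.measurable

/-- The standard Gaussian weight on `E × ℂ`, of total mass one. -/
noncomputable def prodGaussian (z : E × ℂ) : ENNReal :=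
  ENNReal.ofReal (Real.exp (-(Real.pi * prodSqNorm z)))

@[fun_prop]
theorem measurable_prodGaussian [MeasurableSpace E] [BorelSpace E] :
    Measurable (prodGaussian : E × ℂ → ENNReal) := by
  unfold prodGaussian
  have := measurable_prodSqNorm (E := E)
  fun_prop

theorem prodSqNorm_nonneg (z : E × ℂ) : 0 ≤ prodSqNorm z := by unfold prodSqNorm; positivity

theorem prodSqNorm_eq_zero {z : E × ℂ} : prodSqNorm z = 0 ↔ z = 0 := by
  unfold prodSqNorm
  rw [add_eq_zero_iff_of_nonneg (sq_nonneg _) (sq_nonneg _)]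
  simp [Prod.ext_iff]

variable [InnerProductSpace ℝ E]

/-- The radial map `(p, q) ↦ R p / √(‖p‖² + ‖q‖²)` from `E × ℂ` to the ball of radius `R`. -/
noncomputable def ballProj (R : ℝ) (z : E × ℂ) : E := (R / √(prodSqNorm z)) • z.1

variable [FiniteDimensional ℝ E] [MeasurableSpace E] [BorelSpace E]

theorem measurable_ballProj (R : ℝ) : Measurable (ballProj R : E × ℂ → E) := by
  unfold ballProj
  have := measurable_prodSqNorm (E := E)
  fun_prop

open Module Real ENNReal in
theorem lintegral_ball_comp_smul {r R : ℝ} (hr : 0 < r) (hR : 0 < R) {F : E → ℝ≥0∞}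
    (hF : Measurable F) :
    ∫⁻ p in Metric.ball 0 r, F ((R / r) • p)
      = ENNReal.ofReal ((r / R) ^ finrank ℝ E) * ∫⁻ x in Metric.ball 0 R, F x := by
  have hc : R / r ≠ 0 := by positivity
  have hmap := Measure.map_addHaar_smul (volume : Measure E) hc
  have hm : Measurable (fun p : E => (R / r) • p) := by fun_prop
  have hpre : (fun p : E => (R / r) • p) ⁻¹' Metric.ball 0 R = Metric.ball 0 r := by
    ext p
    simp only [Set.mem_preimage, mem_ball_zero_iff, norm_smul, Real.norm_eq_abs,
      abs_of_pos (div_pos hR hr)]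
    rw [div_mul_eq_mul_div, div_lt_iff₀ hr, mul_lt_mul_iff_right₀ hR]
  rw [← hpre, ← setLIntegral_map measurableSet_ball hF hm, hmap, Measure.restrict_smul,
    lintegral_smul_measure, smul_eq_mul]
  congr 2
  rw [abs_of_pos (by positivity), ← inv_pow, inv_div]

open Set Module Real ENNReal in
/-- The radial map `ballProj R` turns a radial weight on `E × ℂ` into a multiple of Lebesgue
measure on the ball of radius `R`. -/
theorem lintegral_comp_ballProj {R : ℝ} (hR : 0 < R) {F : E → ℝ≥0∞} (hF : Measurable F)
    {m : ℝ → ℝ≥0∞} (hm : Measurable m) :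
    ∫⁻ z : E × ℂ, F (ballProj R z) * m (prodSqNorm z)
      = (ENNReal.ofReal π *
          ∫⁻ s in Ioi (0 : ℝ), m s * ENNReal.ofReal ((√s / R) ^ finrank ℝ E)) *
        ∫⁻ x in Metric.ball 0 R, F x := by
  set k : E × ℝ → ℝ≥0∞ := fun y => F ((R / √y.2) • y.1) * m y.2 with hk
  have hkm : Measurable k := by
    have h1 : Measurable fun y : E × ℝ => (R / √y.2) • y.1 := by fun_prop
    exact (hF.comp h1).mul (hm.comp measurable_snd)
  -- For fixed `p`, the variable `s = ‖p‖² + ‖q‖²` carries Lebesgue measure in `q` to `π ds` on `s >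
  -- ‖p‖²`, that is, on those `s` with `p` in the ball of radius `√s`. The density is constant
  -- because `ℂ` has real dimension two, so each `s` contributes a uniform measure on a ball.
  have h1 : ∀ p : E, ∫⁻ q : ℂ, F (ballProj R (p, q)) * m (prodSqNorm (p, q))
      = ENNReal.ofReal π * ∫⁻ s in Ioi (0 : ℝ), (Metric.ball 0 √s).indicator
          (fun p => k (p, s)) p := by
    intro p
    have h2 := Complex.lintegral_comp_norm_sq (h := fun s => k (p, ‖p‖ ^ 2 + s)) (by fun_prop)
    refine h2.trans ?_
    congr 1
    have h3 : ∀ s ∈ Ioi (0 : ℝ), (Metric.ball 0 √s).indicator (fun p => k (p, s)) p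
        = (Ioi (‖p‖ ^ 2)).indicator (fun s => k (p, s)) s := by
      intro s hs
      simp only [indicator, mem_ball_zero_iff, mem_Ioi, Real.lt_sqrt (norm_nonneg _)]
    rw [setLIntegral_congr_fun measurableSet_Ioi h3, lintegral_indicator measurableSet_Ioi,
      Measure.restrict_restrict measurableSet_Ioi,
      inter_eq_left.2 (Ioi_subset_Ioi (sq_nonneg _))]
    rw [← lintegral_indicator measurableSet_Ioi, ← lintegral_indicator measurableSet_Ioi,
      ← lintegral_add_left_eq_self ((Ioi (‖p‖ ^ 2)).indicator fun s => k (p, s)) (‖p‖ ^ 2)]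
    refine lintegral_congr fun s => ?_
    simp only [indicator, mem_Ioi, lt_add_iff_pos_right]
  have hmeas : Measurable fun y : E × ℝ =>
      (Metric.ball (0 : E) √y.2).indicator (fun p => k (p, y.2)) y.1 := by
    have hs : MeasurableSet {y : E × ℝ | ‖y.1‖ < √y.2} :=
      measurableSet_lt (by fun_prop) (by fun_prop)
    convert hkm.indicator hs using 1
    ext y
    simp [indicator]
  have hTm : Measurable fun z : E × ℂ => F (ballProj R z) * m (prodSqNorm z) :=
    (hF.comp (measurable_ballProj R)).mul (hm.comp measurable_prodSqNorm)
  rw [Measure.volume_eq_prod, lintegral_prod _ hTm.aemeasurable]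
  simp_rw [h1]
  rw [lintegral_const_mul _ (by exact Measurable.lintegral_prod_right hmeas),
    lintegral_lintegral_swap (by exact hmeas.aemeasurable), mul_assoc]
  congr 1
  rw [← lintegral_mul_const _ (by fun_prop)]
  refine setLIntegral_congr_fun measurableSet_Ioi fun s hs => ?_
  have hs' : 0 < √s := Real.sqrt_pos.2 hs
  rw [lintegral_indicator measurableSet_ball]
  simp only [hk]
  have hFm : Measurable fun a : E => F ((R / √s) • a) := hF.comp (by fun_prop)
  rw [lintegral_mul_const _ hFm, lintegral_ball_comp_smul hs' hR hF]
  ring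

end Gaussian

/-! ### Moments of Gaussian linear functionals. -/

theorem Real.one_add_sq_div_two_le_cosh (x : ℝ) : 1 + x ^ 2 / 2 ≤ Real.cosh x := by
  have h1 : Real.cosh x = 1 + 2 * Real.sinh (x / 2) ^ 2 := by
    have h2 : x = 2 * (x / 2) := by ring
    conv_lhs => rw [h2, Real.cosh_two_mul, Real.cosh_sq]
    ring
  have h3 : (x / 2) ^ 2 ≤ Real.sinh (x / 2) ^ 2 := by
    rw [sq_le_sq, Real.abs_sinh]
    exact Real.self_le_sinh_iff.2 (abs_nonneg _)
  rw [h1]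
  linarith

/-- The quadratic lower bound for `cosh` combined with the arithmetic–geometric mean inequality. It
lets the moment generating function control a first absolute moment. -/
theorem Real.sqrt_two_mul_abs_le_cosh (x : ℝ) : √2 * |x| ≤ Real.cosh x := by
  refine le_trans ?_ (Real.one_add_sq_div_two_le_cosh x)
  have h1 : √2 ^ 2 = (2 : ℝ) := Real.sq_sqrt (by norm_num)
  have h2 : |x| ^ 2 = x ^ 2 := sq_abs x
  nlinarith [sq_nonneg (√2 - |x|)]

section GaussianMoments

variable {V : Type*} [NormedAddCommGroup V] [InnerProductSpace ℝ V] [FiniteDimensional ℝ V]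
  [MeasurableSpace V] [BorelSpace V]

open Real ENNReal RealInnerProductSpace in
/-- The moment generating function of the centred Gaussian density `exp (-π ‖v‖²)`. -/
theorem lintegral_exp_neg_pi_mul_sq_norm_add_inner (w : V) :
    ∫⁻ v : V, ENNReal.ofReal (rexp (-(π * ‖v‖ ^ 2) + ⟪w, v⟫))
      = ENNReal.ofReal (rexp (‖w‖ ^ 2 / (4 * π))) := by
  have hb : 0 < (π : ℂ).re := by simpa using pi_pos
  have hcoe : ∀ v : V, Complex.exp (-(π : ℂ) * ‖v‖ ^ 2 + (1 : ℂ) * ⟪w, v⟫)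
      = ((rexp (-(π * ‖v‖ ^ 2) + ⟪w, v⟫) : ℝ) : ℂ) := by
    intro v
    push_cast
    congr 1
    ring
  have hint := GaussianFourier.integrable_cexp_neg_mul_sq_norm_add hb 1 w
  have hval := GaussianFourier.integral_cexp_neg_mul_sq_norm_add hb 1 w
  simp_rw [hcoe] at hint hval
  have hint' : Integrable fun v : V => rexp (-(π * ‖v‖ ^ 2) + ⟪w, v⟫) := by
    simpa only [RCLike.re_to_complex, Complex.ofReal_re] using hint.re
  rw [← ofReal_integral_eq_lintegral_ofReal hint' (Filter.Eventually.of_forall fun v => (exp_pos _).le)]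
  congr 1
  rw [integral_complex_ofReal, div_self (by simp [pi_ne_zero]), Complex.one_cpow, one_mul] at hval
  have h2 : Complex.exp (1 ^ 2 * (‖w‖ : ℂ) ^ 2 / (4 * π)) = ((rexp (‖w‖ ^ 2 / (4 * π)) : ℝ) : ℂ) := by
    push_cast
    simp
  rw [h2] at hval
  exact_mod_cast hval

variable {E : Type*} [NormedAddCommGroup E] [InnerProductSpace ℝ E] [FiniteDimensional ℝ E]
  [MeasurableSpace E] [BorelSpace E]

open Real ENNReal RealInnerProductSpace in
theorem lintegral_prodGaussian_mul_exp (a : E) (b : ℂ) :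
    ∫⁻ z : E × ℂ, prodGaussian z * ENNReal.ofReal (rexp (⟪a, z.1⟫ + ⟪b, z.2⟫))
      = ENNReal.ofReal (rexp ((‖a‖ ^ 2 + ‖b‖ ^ 2) / (4 * π))) := by
  have h1 : ∀ z : E × ℂ, prodGaussian z * ENNReal.ofReal (rexp (⟪a, z.1⟫ + ⟪b, z.2⟫))
      = ENNReal.ofReal (rexp (-(π * ‖z.1‖ ^ 2) + ⟪a, z.1⟫))
        * ENNReal.ofReal (rexp (-(π * ‖z.2‖ ^ 2) + ⟪b, z.2⟫)) := by
    intro z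
    rw [prodGaussian, ← ENNReal.ofReal_mul (exp_pos _).le, ← ENNReal.ofReal_mul (exp_pos _).le,
      ← exp_add, ← exp_add, prodSqNorm]
    congr 2
    ring
  simp_rw [h1]
  rw [Measure.volume_eq_prod, lintegral_prod_mul (f := fun p : E => ENNReal.ofReal (rexp (-(π * ‖p‖ ^ 2) + ⟪a, p⟫)))
      (g := fun q : ℂ => ENNReal.ofReal (rexp (-(π * ‖q‖ ^ 2) + ⟪b, q⟫)))
      (by fun_prop) (by fun_prop),
    lintegral_exp_neg_pi_mul_sq_norm_add_inner, lintegral_exp_neg_pi_mul_sq_norm_add_inner,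
    ← ENNReal.ofReal_mul (exp_pos _).le, ← exp_add, add_div]

open Real in
theorem lintegral_prodGaussian : ∫⁻ z : E × ℂ, prodGaussian z = 1 := by
  simpa using lintegral_prodGaussian_mul_exp (0 : E) (0 : ℂ)

open Real ENNReal RealInnerProductSpace in
/-- A first absolute moment bound for linear functionals of a Gaussian vector. -/
theorem lintegral_prodGaussian_mul_abs_inner_le (a : E) (b : ℂ) :
    ∫⁻ z : E × ℂ, prodGaussian z * ENNReal.ofReal |⟪a, z.1⟫ + ⟪b, z.2⟫|
      ≤ ENNReal.ofReal (rexp (1 / 2) / √(4 * π) * √(‖a‖ ^ 2 + ‖b‖ ^ 2)) := by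
  set A := √(‖a‖ ^ 2 + ‖b‖ ^ 2) with hA
  have hA2 : A ^ 2 = ‖a‖ ^ 2 + ‖b‖ ^ 2 := Real.sq_sqrt (by positivity)
  rcases (Real.sqrt_nonneg (‖a‖ ^ 2 + ‖b‖ ^ 2)).eq_or_lt with h0 | hpos
  · rw [← hA] at h0
    have ha : a = 0 := by
      rw [← norm_eq_zero]
      nlinarith [sq_nonneg ‖a‖, sq_nonneg ‖b‖]
    have hb : b = 0 := by
      rw [← norm_eq_zero]
      nlinarith [sq_nonneg ‖a‖, sq_nonneg ‖b‖]
    simp [ha, hb]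
  · rw [← hA] at hpos
    -- This value minimises `exp (l² A² / (4π)) / l`, the bound obtained with parameter `l`; the
    -- exponent becomes `1 / 2`.
    set l := √(2 * π) / A with hl
    have hl0 : 0 < l := by positivity
    have hl2 : l ^ 2 * A ^ 2 = 2 * π := by
      rw [hl, div_pow, Real.sq_sqrt (by positivity)]
      field_simp
    have key : ∀ s : ℝ, |s| ≤ (1 / (2 * √2 * l)) * (rexp (l * s) + rexp (-(l * s))) := by
      intro s
      have h1 := Real.sqrt_two_mul_abs_le_cosh (l * s)
      rw [Real.cosh_eq, abs_mul, abs_of_pos hl0] at h1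
      rw [one_div, inv_mul_eq_div, le_div_iff₀ (by positivity)]
      linarith
    have hmgf : ∀ e : ℝ, e ^ 2 = 1 →
        ∫⁻ z : E × ℂ, prodGaussian z * ENNReal.ofReal (rexp (e * l * (⟪a, z.1⟫ + ⟪b, z.2⟫)))
          = ENNReal.ofReal (rexp (1 / 2)) := by
      intro e he
      have h1 := lintegral_prodGaussian_mul_exp ((e * l) • a) ((e * l) • b)
      simp only [inner_smul_left, RCLike.conj_to_real, ← mul_add] at h1
      rw [h1]
      congr 2
      rw [norm_smul, norm_smul, mul_pow, mul_pow, Real.norm_eq_abs, sq_abs, mul_pow, he, one_mul,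
        ← mul_add, ← hA2, hl2]
      field_simp
      norm_num
    calc ∫⁻ z : E × ℂ, prodGaussian z * ENNReal.ofReal |⟪a, z.1⟫ + ⟪b, z.2⟫|
        ≤ ∫⁻ z : E × ℂ, ENNReal.ofReal (1 / (2 * √2 * l)) *
            (prodGaussian z * ENNReal.ofReal (rexp (1 * l * (⟪a, z.1⟫ + ⟪b, z.2⟫)))
            + prodGaussian z * ENNReal.ofReal (rexp (-1 * l * (⟪a, z.1⟫ + ⟪b, z.2⟫)))) := by
          refine lintegral_mono fun z => ?_
          rw [← mul_add, ← ENNReal.ofReal_add (exp_pos _).le (exp_pos _).le, mul_left_comm,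
            ← ENNReal.ofReal_mul (by positivity)]
          gcongr
          have := key (⟪a, z.1⟫ + ⟪b, z.2⟫)
          simpa [neg_mul] using this
      _ = ENNReal.ofReal (1 / (2 * √2 * l)) *
            (ENNReal.ofReal (rexp (1 / 2)) + ENNReal.ofReal (rexp (1 / 2))) := by
          rw [lintegral_const_mul _ (by fun_prop), lintegral_add_left (by fun_prop),
            hmgf 1 (by norm_num), hmgf (-1) (by norm_num)]
      _ = ENNReal.ofReal (rexp (1 / 2) / √(4 * π) * A) := by
          rw [← ENNReal.ofReal_add (exp_pos _).le (exp_pos _).le,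
            ← ENNReal.ofReal_mul (by positivity)]
          congr 1
          have h4 : √(4 * π) = √2 * √(2 * π) := by
            rw [← Real.sqrt_mul (by norm_num)]
            congr 1
            ring
          rw [h4, hl]
          field_simp
          ring

end GaussianMoments

/-! ### Invariance under plane rotations. -/

section Rotation

variable {H : Type*} [AddCommGroup H] [Module ℝ H] [MeasurableSpace H] [MeasurableAdd₂ H]
  [MeasurableSMul ℝ H] {μ : Measure H} [SFinite μ] [μ.IsAddLeftInvariant]

theorem measurePreserving_shear_snd (b : ℝ) :
    MeasurePreserving (fun y : H × H => (y.1, y.2 + b • y.1)) (μ.prod μ) (μ.prod μ) := by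
  have hm : Measurable fun y : H × H => y.2 + b • y.1 :=
    measurable_snd.add (measurable_fst.const_smul b)
  refine (MeasurePreserving.id μ).skew_product (g := fun x y => y + b • x) hm ?_
  refine Filter.Eventually.of_forall fun x => ?_
  simp_rw [add_comm _ (b • x)]
  exact map_add_left_eq_self μ (b • x)

theorem measurePreserving_shear_fst (a : ℝ) :
    MeasurePreserving (fun y : H × H => (y.1 + a • y.2, y.2)) (μ.prod μ) (μ.prod μ) :=
  Measure.measurePreserving_swap.comp
    ((measurePreserving_shear_snd a).comp Measure.measurePreserving_swap)

/-- Plane rotations of `H × H` preserve the product of an invariant measure with itself. -/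
theorem measurePreserving_rotation {t : ℝ} (ht : 0 < 1 + Real.cos t) :
    MeasurePreserving (fun y : H × H => (Real.cos t • y.1 + Real.sin t • y.2,
      (-Real.sin t) • y.1 + Real.cos t • y.2)) (μ.prod μ) (μ.prod μ) := by
  -- Here `a = tan (t / 2)`: a rotation is a product of three shears, with parameters `a`, `-sin t`,
  -- `a`. Each shear preserves the measure by translation invariance, so no determinant is needed.
  set a := Real.sin t / (1 + Real.cos t) with ha
  have h1 : a * (1 + Real.cos t) = Real.sin t := div_mul_cancel₀ _ ht.ne'
  have h2 : a * Real.sin t = 1 - Real.cos t := by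
    rw [ha, div_mul_eq_mul_div, div_eq_iff ht.ne']
    linear_combination Real.sin_sq_add_cos_sq t
  convert (measurePreserving_shear_fst (μ := μ) a).comp
    ((measurePreserving_shear_snd (μ := μ) (-Real.sin t)).comp
      (measurePreserving_shear_fst (μ := μ) a)) using 1
  funext y
  refine Prod.ext ?_ ?_
  · simp only [Function.comp_apply]
    match_scalars
    · linear_combination h2
    · linear_combination -h1 + a * h2
  · simp only [Function.comp_apply]
    match_scalars
    · ring
    · linear_combination h2

end Rotation

/-! ### Differentiation of `f ∘ ballProj R` along rotation paths. -/

section PathDerivative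

variable {E : Type*} [NormedAddCommGroup E] [InnerProductSpace ℝ E]

open RealInnerProductSpace in
/-- The `E`-component of the adjoint of the derivative of `ballProj R` at `z`, applied to `ξ`. -/
noncomputable def ballProjAdjFst (R : ℝ) (ξ : E) (z : E × ℂ) : E :=
  (R / √(prodSqNorm z)) • (ξ - (⟪ξ, z.1⟫ / prodSqNorm z) • z.1)

open RealInnerProductSpace in
/-- The `ℂ`-component of the adjoint of the derivative of `ballProj R` at `z`, applied to `ξ`. -/
noncomputable def ballProjAdjSnd (R : ℝ) (ξ : E) (z : E × ℂ) : ℂ :=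
  (-(R / √(prodSqNorm z)) * (⟪ξ, z.1⟫ / prodSqNorm z)) • z.2

/-- The map `ballProj R` is homogeneous of degree zero, so its adjoint derivative takes `ξ` to `R /
‖z‖` times the component of `(ξ, 0)` orthogonal to `z` (Euclidean norm on `E × ℂ`). Orthogonal
projection does not increase the norm. -/
theorem sqrt_norm_ballProjAdj_le {R : ℝ} (hR : 0 ≤ R) (ξ : E) (z : E × ℂ) :
    √(‖ballProjAdjFst R ξ z‖ ^ 2 + ‖ballProjAdjSnd R ξ z‖ ^ 2)
      ≤ R * (1 / √(prodSqNorm z)) * ‖ξ‖ := by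
  rcases (prodSqNorm_nonneg z).eq_or_lt with h0 | hpos
  · simp [ballProjAdjFst, ballProjAdjSnd, ← h0]
  rw [Real.sqrt_le_left (by positivity), ballProjAdjFst, ballProjAdjSnd, norm_smul, norm_smul,
    mul_pow, mul_pow, norm_sub_sq_real, norm_smul, inner_smul_right, Real.norm_eq_abs,
    Real.norm_eq_abs, Real.norm_eq_abs, mul_pow, sq_abs, sq_abs, sq_abs]
  set N := prodSqNorm z with hN
  have hN' : ‖z.2‖ ^ 2 = N - ‖z.1‖ ^ 2 := by rw [hN, prodSqNorm]; ring
  set c := inner ℝ ξ z.1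
  rw [hN']
  have h1 : (R / √N) ^ 2 * (‖ξ‖ ^ 2 - 2 * (c / N * c) + (c / N) ^ 2 * ‖z.1‖ ^ 2)
      + (-(R / √N) * (c / N)) ^ 2 * (N - ‖z.1‖ ^ 2)
      = (R * (1 / √N) * ‖ξ‖) ^ 2 - (R / √N) ^ 2 * (c ^ 2 / N) := by
    field_simp
    ring
  rw [h1]
  have : 0 ≤ (R / √N) ^ 2 * (c ^ 2 / N) := by positivity
  linarith

open RealInnerProductSpace in
/-- The derivative of `f ∘ ballProj R` at `z` in the direction `w`. -/
noncomputable def ballProjDeriv [CompleteSpace E] (f : E → ℝ) (R : ℝ) (z w : E × ℂ) : ℝ :=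
  ⟪ballProjAdjFst R (gradient f (ballProj R z)) z, w.1⟫
    + ⟪ballProjAdjSnd R (gradient f (ballProj R z)) z, w.2⟫

open RealInnerProductSpace in
theorem hasDerivAt_comp_ballProj [CompleteSpace E] {f : E → ℝ} (hf : Differentiable ℝ f)
    (R : ℝ) {z : ℝ → E × ℂ} {w : E × ℂ} {t : ℝ} (hz : HasDerivAt z w t) (h0 : z t ≠ 0) :
    HasDerivAt (fun s => f (ballProj R (z s))) (ballProjDeriv f R (z t) w) t := by
  have h1 : HasDerivAt (fun s => (z s).1) w.1 t := hz.fst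
  have h2 : HasDerivAt (fun s => (z s).2) w.2 t := hz.snd
  have hN : HasDerivAt (fun s => prodSqNorm (z s))
      (2 * ⟪(z t).1, w.1⟫ + 2 * ⟪(z t).2, w.2⟫) t := h1.norm_sq.add h2.norm_sq
  have hN0 : prodSqNorm (z t) ≠ 0 := fun h => h0 (prodSqNorm_eq_zero.1 h)
  have hpos : 0 < prodSqNorm (z t) := lt_of_le_of_ne (prodSqNorm_nonneg _) hN0.symm
  have hs := hN.sqrt hN0
  have hd := ((hasDerivAt_const t R).fun_div hs (Real.sqrt_pos.2 hpos).ne').fun_smul h1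
  have hT : HasDerivAt (fun s => ballProj R (z s)) _ t := hd
  have hfg := (hf (ballProj R (z t))).hasGradientAt.hasFDerivAt.comp_hasDerivAt t hT
  refine HasDerivAt.congr_deriv (f := fun s => f (ballProj R (z s))) hfg ?_
  rw [InnerProductSpace.toDual_apply_apply]
  unfold ballProjDeriv ballProjAdjFst ballProjAdjSnd
  set ξ := gradient f (ballProj R (z t))
  simp only [inner_smul_left, inner_sub_left, inner_add_right, inner_smul_right,
    RCLike.conj_to_real]
  have hsq : √(prodSqNorm (z t)) ^ 2 = prodSqNorm (z t) := Real.sq_sqrt hpos.le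
  set r := √(prodSqNorm (z t)) with hr
  have hr0 : 0 < r := Real.sqrt_pos.2 hpos
  rw [← hsq]
  field_simp
  ring

-- The fundamental theorem of calculus along the arc from `z` at `t = 0` to `w` at `t = π / 2`.
-- Avoiding the origin keeps `ballProj R` smooth on the arc.
open Set Real in
theorem enorm_comp_ballProj_sub_le [CompleteSpace E] {f : E → ℝ} (hf : ContDiff ℝ 1 f)
    (R : ℝ) {z w : E × ℂ} (hzw : ∀ t : ℝ, cos t • z + sin t • w ≠ 0) :
    ‖f (ballProj R w) - f (ballProj R z)‖ₑ
      ≤ ∫⁻ t in Icc 0 (π / 2), ‖ballProjDeriv f R (cos t • z + sin t • w)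
          ((-sin t) • z + cos t • w)‖ₑ := by
  set γ : ℝ → E × ℂ := fun t => cos t • z + sin t • w with hγ
  have hd : ∀ t, HasDerivAt (fun s => f (ballProj R (γ s)))
      (ballProjDeriv f R (γ t) ((-sin t) • z + cos t • w)) t := by
    intro t
    refine hasDerivAt_comp_ballProj (hf.differentiable one_ne_zero) R ?_ (hzw t)
    exact ((hasDerivAt_cos t).smul_const z).add ((hasDerivAt_sin t).smul_const w)
  have hN0 : ∀ t, prodSqNorm (γ t) ≠ 0 := fun t h => hzw t (prodSqNorm_eq_zero.1 h)
  have hγc : ContDiff ℝ 1 γ :=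
    (contDiff_cos.smul contDiff_const).add (contDiff_sin.smul contDiff_const)
  have hNc : ContDiff ℝ 1 fun s => prodSqNorm (γ s) :=
    (hγc.fst.norm_sq ℝ).add (hγc.snd.norm_sq ℝ)
  have hc : ContDiff ℝ 1 fun s => f (ballProj R (γ s)) := by
    refine hf.comp ?_
    refine ContDiff.smul (contDiff_const.div (hNc.sqrt hN0) fun t => ?_) hγc.fst
    exact (Real.sqrt_pos.2 (lt_of_le_of_ne (prodSqNorm_nonneg _) (hN0 t).symm)).ne'
  have key := enorm_sub_le_lintegral_deriv_of_contDiffOn_Icc (a := 0) (b := π / 2)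
    hc.contDiffOn (by positivity)
  simp only [(hd _).deriv] at key
  simpa [hγ] using key

/-- A rotation of the pair preserves the sum of the two squared norms, so position and velocity on
the path have the same joint density as the endpoints. -/
theorem prodGaussian_rotation (t : ℝ) (z w : E × ℂ) :
    prodGaussian (Real.cos t • z + Real.sin t • w)
        * prodGaussian ((-Real.sin t) • z + Real.cos t • w)
      = prodGaussian z * prodGaussian w := by
  unfold prodGaussian
  rw [← ENNReal.ofReal_mul (Real.exp_pos _).le, ← ENNReal.ofReal_mul (Real.exp_pos _).le,
    ← Real.exp_add, ← Real.exp_add]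
  congr 2
  have key : prodSqNorm (Real.cos t • z + Real.sin t • w)
        + prodSqNorm ((-Real.sin t) • z + Real.cos t • w) = prodSqNorm z + prodSqNorm w := by
    unfold prodSqNorm
    simp only [Prod.fst_add, Prod.snd_add, Prod.smul_fst, Prod.smul_snd, norm_add_sq_real,
      norm_smul, inner_smul_left, inner_smul_right, mul_pow, Real.norm_eq_abs, sq_abs,
      RCLike.conj_to_real]
    linear_combination (‖z.1‖ ^ 2 + ‖z.2‖ ^ 2 + ‖w.1‖ ^ 2 + ‖w.2‖ ^ 2) * Real.sin_sq_add_cos_sq t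
  linear_combination (-Real.pi) * key

variable [FiniteDimensional ℝ E] [MeasurableSpace E] [BorelSpace E]

theorem measurable_ballProjDeriv {f : E → ℝ} (hf : ContDiff ℝ 1 f) (R : ℝ) :
    Measurable fun y : (E × ℂ) × (E × ℂ) => ballProjDeriv f R y.1 y.2 := by
  have h1 : Continuous (gradient f) :=
    (LinearIsometryEquiv.continuous _).comp (hf.continuous_fderiv one_ne_zero)
  have h2 : Measurable fun y : (E × ℂ) × (E × ℂ) => gradient f (ballProj R y.1) :=
    h1.measurable.comp ((measurable_ballProj R).comp measurable_fst)
  have h3 : Measurable fun y : (E × ℂ) × (E × ℂ) => prodSqNorm y.1 :=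
    measurable_prodSqNorm.comp measurable_fst
  unfold ballProjDeriv ballProjAdjFst ballProjAdjSnd
  fun_prop

end PathDerivative

/-! ### Numerical constants of the Gaussian argument. -/

open Set Real ENNReal in
theorem lintegral_rpow_mul_exp_neg_pi {a : ℝ} (ha : 0 < a) :
    ∫⁻ s in Ioi (0 : ℝ), ENNReal.ofReal (s ^ (a - 1) * rexp (-(π * s)))
      = ENNReal.ofReal ((1 / π) ^ a * Gamma a) := by
  have h1 := Real.integral_rpow_mul_exp_neg_mul_Ioi ha pi_pos
  have hne : (1 / π) ^ a * Gamma a ≠ 0 := (mul_pos (by positivity) (Gamma_pos_of_pos ha)).ne'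
  have hint : IntegrableOn (fun s : ℝ => s ^ (a - 1) * rexp (-(π * s))) (Ioi 0) := by
    -- The integral of a non-integrable function is zero by convention, while the Gamma value is
    -- positive.
    by_contra hn
    rw [integral_undef hn] at h1
    exact hne h1.symm
  rw [← h1, ofReal_integral_eq_lintegral_ofReal hint]
  filter_upwards [self_mem_ae_restrict measurableSet_Ioi] with s hs
  exact mul_nonneg (rpow_nonneg (le_of_lt hs) _) (exp_pos _).le

open Set Real ENNReal in
/-- The mean of the inverse distance to the origin under a Gaussian law in dimension `n + 2`. -/
theorem lintegral_exp_mul_inv_sqrt_mul_pow_le {R : ℝ} (hR : 0 < R) {n : ℕ} (hn : 1 ≤ n) :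
    ∫⁻ s in Ioi (0 : ℝ), ENNReal.ofReal (rexp (-(π * s))) * ENNReal.ofReal (1 / √s)
          * ENNReal.ofReal ((√s / R) ^ n)
      ≤ ENNReal.ofReal (1 + π / 2) *
        ∫⁻ s in Ioi (0 : ℝ), ENNReal.ofReal (rexp (-(π * s))) * ENNReal.ofReal ((√s / R) ^ n) := by
  set a : ℝ := n / 2 with ha
  have hn' : (1 : ℝ) ≤ n := by exact_mod_cast hn
  have ha0 : 0 < a := by positivity
  set c := ENNReal.ofReal ((1 / R) ^ n) with hc
  have hpow : ∀ s : ℝ, 0 < s → (√s / R) ^ n = (1 / R) ^ n * s ^ (a + 1 - 1) := by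
    intro s hs
    rw [div_pow, add_sub_cancel_right, ha, Real.sqrt_eq_rpow, ← Real.rpow_natCast,
      ← Real.rpow_mul hs.le, one_div_mul_eq_div]
    ring
  have hpow' : ∀ s : ℝ, 0 < s → s ^ (a - 1) * s = s ^ (a + 1 - 1) := by
    intro s hs
    rw [← Real.rpow_add_one hs.ne']
    congr 1
    ring
  have h0 : ∫⁻ s in Ioi (0 : ℝ), ENNReal.ofReal (rexp (-(π * s))) * ENNReal.ofReal ((√s / R) ^ n)
      = c * ENNReal.ofReal ((1 / π) ^ (a + 1) * Gamma (a + 1)) := by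
    rw [← lintegral_rpow_mul_exp_neg_pi (by positivity), ← lintegral_const_mul _ (by fun_prop)]
    refine setLIntegral_congr_fun measurableSet_Ioi fun s hs => ?_
    have hs' : 0 < s := hs
    rw [hpow s hs, ← ENNReal.ofReal_mul (by positivity), ← ENNReal.ofReal_mul (by positivity)]
    congr 1
    ring
  -- The ratio of the two moments is `π / a = 2π / n`, at most `2π` because `n ≥ 1`.
  have hG : (1 / π) ^ a * Gamma a ≤ 2 * π * ((1 / π) ^ (a + 1) * Gamma (a + 1)) := by
    have hg : 0 < (1 / π) ^ a * Gamma a := mul_pos (by positivity) (Gamma_pos_of_pos ha0)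
    rw [Real.Gamma_add_one ha0.ne', Real.rpow_add_one (by positivity)]
    have : 2 * π * ((1 / π) ^ a * (1 / π) * (a * Gamma a)) = n * ((1 / π) ^ a * Gamma a) := by
      rw [ha]
      field_simp
    rw [this]
    nlinarith
  calc ∫⁻ s in Ioi (0 : ℝ), ENNReal.ofReal (rexp (-(π * s))) * ENNReal.ofReal (1 / √s)
          * ENNReal.ofReal ((√s / R) ^ n)
      ≤ ∫⁻ s in Ioi (0 : ℝ), (c * ENNReal.ofReal (s ^ (a + 1 - 1) * rexp (-(π * s)))
          + c * (ENNReal.ofReal (1 / 4) * ENNReal.ofReal (s ^ (a - 1) * rexp (-(π * s))))) := by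
        refine setLIntegral_mono' measurableSet_Ioi fun s hs => ?_
        have hs' : 0 < s := hs
        rw [hpow s hs, ← mul_add, ← ENNReal.ofReal_mul (by positivity),
          ← ENNReal.ofReal_mul (by positivity), ← ENNReal.ofReal_mul (by positivity),
          ← ENNReal.ofReal_add (by positivity) (by positivity),
          ← ENNReal.ofReal_mul (by positivity)]
        refine ENNReal.ofReal_le_ofReal ?_
        rw [← hpow' s hs]
        have hr : 0 < √s := Real.sqrt_pos.2 hs
        have hr2 : √s ^ 2 = s := Real.sq_sqrt hs'.le
        -- This is `1 / √s ≤ 1 + 1 / (4 s)` multiplied by `s`. It replaces the half-integral moment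
        -- by two moments related by the functional equation of Gamma; with `hG`, the term in `1 /
        -- (4 s)` contributes `π / 2`.
        have h1 : 1 / √s * s ≤ s + 1 / 4 := by
          have : 1 / √s * s = √s := by
            nth_rewrite 2 [← hr2]
            field_simp
          rw [this]
          nlinarith [sq_nonneg (√s - 1 / 2)]
        have h2 : 0 ≤ rexp (-(π * s)) * (1 / R) ^ n * s ^ (a - 1) := by positivity
        nlinarith [mul_le_mul_of_nonneg_left h1 h2]
    _ = c * ENNReal.ofReal ((1 / π) ^ (a + 1) * Gamma (a + 1))
          + c * (ENNReal.ofReal (1 / 4) * ENNReal.ofReal ((1 / π) ^ a * Gamma a)) := by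
        rw [lintegral_add_left (by fun_prop), lintegral_const_mul _ (by fun_prop),
          lintegral_const_mul _ (by fun_prop), lintegral_const_mul _ (by fun_prop),
          lintegral_rpow_mul_exp_neg_pi (by positivity), lintegral_rpow_mul_exp_neg_pi ha0]
    _ ≤ ENNReal.ofReal (1 + π / 2) * (c * ENNReal.ofReal ((1 / π) ^ (a + 1) * Gamma (a + 1))) := by
        have hg : 0 < Gamma a := Gamma_pos_of_pos ha0
        have hg1 : 0 < Gamma (a + 1) := Gamma_pos_of_pos (by positivity)
        rw [hc, ← ENNReal.ofReal_mul (by positivity), ← ENNReal.ofReal_mul (by positivity),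
          ← ENNReal.ofReal_mul (by positivity), ← ENNReal.ofReal_add (by positivity) (by positivity),
          ← ENNReal.ofReal_mul (by positivity)]
        refine ENNReal.ofReal_le_ofReal ?_
        have h2 : 0 ≤ (1 / R) ^ n := by positivity
        nlinarith [mul_le_mul_of_nonneg_left hG h2]
    _ = _ := by rw [h0]

-- The factors are the length of the angular interval, the first moment constant, and the bound for
-- the mean of `1 / ‖z‖`. Their product is about `1.88`, and `2` is what the symmetric double
-- integral allows.
open Real in
theorem pi_div_two_mul_gaussian_constant_le :
    π / 2 * (rexp (1 / 2) / √(4 * π)) * (1 + π / 2) ≤ 2 := by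
  have h1 : rexp (1 / 2) ≤ 1.65 := by
    have h2 : rexp (1 / 2) ^ 2 = rexp 1 := by
      rw [← Real.exp_nat_mul]
      norm_num
    have := Real.exp_one_lt_d9
    nlinarith [Real.exp_pos (1 / 2)]
  have hpi := Real.pi_lt_d2
  have hpi' := Real.pi_gt_d2
  have h3 : 3.54 ≤ √(4 * π) := by
    refine Real.le_sqrt_of_sq_le ?_
    nlinarith
  have h5 : rexp (1 / 2) / √(4 * π) ≤ 1.65 / 3.54 := by gcongr
  calc π / 2 * (rexp (1 / 2) / √(4 * π)) * (1 + π / 2)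
      ≤ 3.15 / 2 * (1.65 / 3.54) * (1 + 3.15 / 2) := by gcongr
    _ ≤ 2 := by norm_num

/-! ### The `L¹` Poincaré inequality for `C¹` functions on a ball. -/

section Poincare

variable {E : Type*} [NormedAddCommGroup E] [InnerProductSpace ℝ E] [FiniteDimensional ℝ E]
  [MeasurableSpace E] [BorelSpace E]

theorem isAddHaarMeasure_volume_prod_complex :
    (volume : Measure (E × ℂ)).IsAddHaarMeasure :=
  Measure.prod.instIsAddHaarMeasure (volume : Measure E) (volume : Measure ℂ)

-- For `z ≠ 0` a path through the origin forces `w` onto the line spanned by `z`, a null set since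
-- `E × ℂ` has dimension at least two.
open Real in
theorem ae_forall_cos_smul_add_sin_smul_ne_zero :
    ∀ᵐ z : E × ℂ, ∀ᵐ w : E × ℂ, ∀ t : ℝ, cos t • z + sin t • w ≠ 0 := by
  have hhaar := isAddHaarMeasure_volume_prod_complex (E := E)
  have hfr : 1 < Module.finrank ℝ (E × ℂ) := by
    rw [Module.finrank_prod, Complex.finrank_real_complex]
    omega
  have hz : ∀ᵐ z : E × ℂ, z ≠ 0 := by
    rw [ae_iff]
    simp
  filter_upwards [hz] with z hz
  have hs : Submodule.span ℝ {z} ≠ ⊤ := by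
    intro h
    have h1 := finrank_span_singleton (K := ℝ) hz
    rw [h, finrank_top] at h1
    omega
  have := Measure.addHaar_submodule (volume : Measure (E × ℂ)) _ hs
  have hw : ∀ᵐ w : E × ℂ, w ∉ Submodule.span ℝ {z} := by
    rw [ae_iff]
    simpa using this
  filter_upwards [hw] with w hw t h
  by_cases ht : sin t = 0
  · rw [ht, zero_smul, add_zero, smul_eq_zero] at h
    have := sin_sq_add_cos_sq t
    rcases h with h | h
    · simp [ht, h] at this
    · exact hz h
  · apply hw
    rw [Submodule.mem_span_singleton]
    refine ⟨-(cos t / sin t), ?_⟩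
    have h1 : sin t • w = -(cos t • z) := eq_neg_of_add_eq_zero_right h
    rw [← inv_smul_smul₀ ht w, h1, smul_neg, smul_smul, neg_smul, div_eq_inv_mul]

open Set Real ENNReal in
/-- Two independent Gaussian vectors are joined by rotation in the plane they span. -/
theorem lintegral_prodGaussian_enorm_sub_le {f : E → ℝ} (hf : ContDiff ℝ 1 f) (R : ℝ) :
    ∫⁻ z : E × ℂ, ∫⁻ w : E × ℂ,
        prodGaussian z * prodGaussian w * ‖f (ballProj R w) - f (ballProj R z)‖ₑ
      ≤ ENNReal.ofReal (π / 2) * ∫⁻ z : E × ℂ, ∫⁻ w : E × ℂ,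
          prodGaussian z * prodGaussian w * ‖ballProjDeriv f R z w‖ₑ := by
  have hhaar := isAddHaarMeasure_volume_prod_complex (E := E)
  have hD := measurable_ballProjDeriv hf R
  set Φ : (E × ℂ) × (E × ℂ) → ℝ≥0∞ := fun y =>
    prodGaussian y.1 * prodGaussian y.2 * ‖ballProjDeriv f R y.1 y.2‖ₑ with hΦ
  have hΦm : Measurable Φ := by
    have h1 : Measurable fun y : (E × ℂ) × (E × ℂ) => prodGaussian y.1 :=
      measurable_prodGaussian.comp measurable_fst
    have h2 : Measurable fun y : (E × ℂ) × (E × ℂ) => prodGaussian y.2 :=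
      measurable_prodGaussian.comp measurable_snd
    exact (h1.mul h2).mul hD.enorm
  set rot : ℝ → (E × ℂ) × (E × ℂ) → (E × ℂ) × (E × ℂ) := fun t y =>
    (cos t • y.1 + sin t • y.2, (-sin t) • y.1 + cos t • y.2) with hrot
  have hrotm : Measurable fun x : ((E × ℂ) × (E × ℂ)) × ℝ => rot x.2 x.1 := by
    simp only [hrot]
    fun_prop
  calc ∫⁻ z : E × ℂ, ∫⁻ w : E × ℂ,
        prodGaussian z * prodGaussian w * ‖f (ballProj R w) - f (ballProj R z)‖ₑ
      ≤ ∫⁻ z : E × ℂ, ∫⁻ w : E × ℂ, ∫⁻ t in Icc 0 (π / 2), Φ (rot t (z, w)) := by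
        refine lintegral_mono_ae ?_
        filter_upwards [ae_forall_cos_smul_add_sin_smul_ne_zero (E := E)] with z hz
        refine lintegral_mono_ae ?_
        filter_upwards [hz] with w hw
        refine (mul_le_mul_right (enorm_comp_ballProj_sub_le hf R hw) _).trans ?_
        refine (lintegral_const_mul_le _ _).trans_eq ?_
        refine lintegral_congr fun t => ?_
        simp only [hΦ, hrot, prodGaussian_rotation]
    _ = ∫⁻ y : (E × ℂ) × (E × ℂ), ∫⁻ t in Icc 0 (π / 2), Φ (rot t y) := by
        rw [Measure.volume_eq_prod (E × ℂ), lintegral_prod]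
        exact (Measurable.lintegral_prod_right' (hΦm.comp hrotm)).aemeasurable
    _ = ∫⁻ t in Icc 0 (π / 2), ∫⁻ y : (E × ℂ) × (E × ℂ), Φ (rot t y) :=
        lintegral_lintegral_swap (hΦm.comp hrotm).aemeasurable
    -- For each `t` the rotation preserves Lebesgue measure on pairs, so the inner integral does not
    -- depend on `t`.
    _ = ∫⁻ t in Icc 0 (π / 2), ∫⁻ y : (E × ℂ) × (E × ℂ), Φ y := by
        refine setLIntegral_congr_fun measurableSet_Icc fun t ht => ?_
        have hc : 0 < 1 + cos t := by
          have := cos_nonneg_of_mem_Icc ⟨by linarith [ht.1, pi_pos], ht.2⟩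
          linarith
        exact (measurePreserving_rotation (μ := (volume : Measure (E × ℂ))) hc).lintegral_comp hΦm
    _ = ENNReal.ofReal (π / 2) * ∫⁻ z : E × ℂ, ∫⁻ w : E × ℂ, Φ (z, w) := by
        rw [lintegral_const, Measure.restrict_apply MeasurableSet.univ, univ_inter,
          Real.volume_Icc, sub_zero, mul_comm, Measure.volume_eq_prod (E × ℂ),
          lintegral_prod _ hΦm.aemeasurable]

open Set Real ENNReal Module in
/-- An `L¹` Poincaré inequality on balls: the mean oscillation of a `C¹` function is controlled by
its gradient, with constant twice the radius. -/
theorem lintegral_ball_enorm_sub_le {f : E → ℝ} (hf : ContDiff ℝ 1 f) {R : ℝ} (hR : 0 < R)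
    (hE : 1 ≤ finrank ℝ E) :
    ∫⁻ x in Metric.ball (0 : E) R, ∫⁻ y in Metric.ball (0 : E) R, ‖f y - f x‖ₑ
      ≤ ENNReal.ofReal (2 * R) * volume (Metric.ball (0 : E) R)
        * ∫⁻ x in Metric.ball (0 : E) R, ‖fderiv ℝ f x‖ₑ := by
  set B := Metric.ball (0 : E) R
  set n := finrank ℝ E
  set κ := rexp (1 / 2) / √(4 * π) with hκ
  set J := ∫⁻ s in Ioi (0 : ℝ), ENNReal.ofReal (rexp (-(π * s))) * ENNReal.ofReal ((√s / R) ^ n)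
  set C := ENNReal.ofReal π * J with hC
  have hfm : Measurable f := hf.continuous.measurable
  have hf'm : Measurable fun x => ‖fderiv ℝ f x‖ₑ :=
    (hf.continuous_fderiv one_ne_zero).measurable.enorm
  have hexp : Measurable fun s : ℝ => ENNReal.ofReal (rexp (-(π * s))) := by fun_prop
  -- `C` is the constant density on `B` of the projected Gaussian law; testing with the function `1`
  -- normalises it.
  have hCB : C * volume B = 1 := by
    have h1 := lintegral_comp_ballProj (E := E) hR (F := fun _ => 1) measurable_const hexp
    simp only [one_mul, lintegral_one, Measure.restrict_apply MeasurableSet.univ, univ_inter] at h1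
    exact h1.symm.trans lintegral_prodGaussian
  have hleft : ∫⁻ z : E × ℂ, ∫⁻ w : E × ℂ,
        prodGaussian z * prodGaussian w * ‖f (ballProj R w) - f (ballProj R z)‖ₑ
      = C * (C * ∫⁻ x in B, ∫⁻ y in B, ‖f y - f x‖ₑ) := by
    have h1 : ∀ z : E × ℂ, ∫⁻ w : E × ℂ,
        prodGaussian z * prodGaussian w * ‖f (ballProj R w) - f (ballProj R z)‖ₑ
        = (C * ∫⁻ y in B, ‖f y - f (ballProj R z)‖ₑ) * prodGaussian z := by
      intro z
      have h2 := lintegral_comp_ballProj (E := E) hR (F := fun y => ‖f y - f (ballProj R z)‖ₑ)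
        (by fun_prop) hexp
      rw [← h2, mul_comm _ (prodGaussian z), ← lintegral_const_mul]
      · refine lintegral_congr fun w => ?_
        rw [mul_assoc, mul_comm (prodGaussian w)]
        rfl
      · have h3 : Measurable fun w : E × ℂ => ‖f (ballProj R w) - f (ballProj R z)‖ₑ :=
          ((hfm.comp (measurable_ballProj R)).sub_const _).enorm
        exact h3.mul measurable_prodGaussian
    simp_rw [h1]
    have hm : Measurable fun x => ∫⁻ y in B, ‖f y - f x‖ₑ :=
      Measurable.lintegral_prod_right' (f := fun p : E × E => ‖f p.2 - f p.1‖ₑ) (by fun_prop)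
    have h4 := lintegral_comp_ballProj (E := E) hR (F := fun x => C * ∫⁻ y in B, ‖f y - f x‖ₑ)
      (hm.const_mul C) hexp
    rw [lintegral_const_mul _ hm] at h4
    exact h4
  have hright : ∫⁻ z : E × ℂ, ∫⁻ w : E × ℂ,
          prodGaussian z * prodGaussian w * ‖ballProjDeriv f R z w‖ₑ
      ≤ ENNReal.ofReal (κ * R) * (ENNReal.ofReal (1 + π / 2) * C
          * ∫⁻ x in B, ‖fderiv ℝ f x‖ₑ) := by
    -- For fixed `z` the derivative is linear in the Gaussian vector `w`, so its first absolute
    -- moment is at most `κ` times the norm of the adjoint derivative applied to the gradient.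
    have h1 : ∀ z : E × ℂ, ∫⁻ w : E × ℂ,
          prodGaussian z * prodGaussian w * ‖ballProjDeriv f R z w‖ₑ
        ≤ ENNReal.ofReal (κ * R) * (‖fderiv ℝ f (ballProj R z)‖ₑ * (ENNReal.ofReal (rexp (-(π * prodSqNorm z))) *
            ENNReal.ofReal (1 / √(prodSqNorm z)))) := by
      intro z
      simp_rw [mul_assoc]
      rw [lintegral_const_mul']
      swap
      · exact ENNReal.ofReal_ne_top
      simp_rw [Real.enorm_eq_ofReal_abs]
      refine (mul_le_mul_right (lintegral_prodGaussian_mul_abs_inner_le _ _) _).trans ?_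
      refine (mul_le_mul_right (ENNReal.ofReal_le_ofReal (mul_le_mul_of_nonneg_left
        (sqrt_norm_ballProjAdj_le hR.le _ z) (by positivity))) _).trans_eq ?_
      have hg : ‖gradient f (ballProj R z)‖ = ‖fderiv ℝ f (ballProj R z)‖ :=
        LinearIsometryEquiv.norm_map _ _
      rw [hg, ← hκ, show κ * (R * (1 / √(prodSqNorm z)) * ‖fderiv ℝ f (ballProj R z)‖)
        = κ * R * (‖fderiv ℝ f (ballProj R z)‖ * (1 / √(prodSqNorm z))) by ring,
        ENNReal.ofReal_mul (by positivity), ENNReal.ofReal_mul (norm_nonneg _), ofReal_norm,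
        prodGaussian]
      ring
    refine (lintegral_mono h1).trans ?_
    rw [lintegral_const_mul' _ _ ENNReal.ofReal_ne_top,
      lintegral_comp_ballProj hR (F := fun x => ‖fderiv ℝ f x‖ₑ) hf'm
        (m := fun s => ENNReal.ofReal (rexp (-(π * s))) * ENNReal.ofReal (1 / √s)) (by fun_prop)]
    refine mul_le_mul_right (mul_le_mul_left ?_ _) _
    rw [hC, mul_left_comm]
    exact mul_le_mul_right (lintegral_exp_mul_inv_sqrt_mul_pow_le hR hE) _
  have hmain := (hleft.symm.le.trans (lintegral_prodGaussian_enorm_sub_le hf R)).trans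
    (mul_le_mul_right hright _)
  calc ∫⁻ x in B, ∫⁻ y in B, ‖f y - f x‖ₑ
      = volume B * volume B * (C * (C * ∫⁻ x in B, ∫⁻ y in B, ‖f y - f x‖ₑ)) := by
        rw [show volume B * volume B * (C * (C * ∫⁻ x in B, ∫⁻ y in B, ‖f y - f x‖ₑ))
          = (C * volume B) * ((C * volume B) * ∫⁻ x in B, ∫⁻ y in B, ‖f y - f x‖ₑ) by ring,
          hCB, one_mul, one_mul]
    _ ≤ volume B * volume B * (ENNReal.ofReal (π / 2) * (ENNReal.ofReal (κ * R) *
          (ENNReal.ofReal (1 + π / 2) * C * ∫⁻ x in B, ‖fderiv ℝ f x‖ₑ))) := by gcongr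
    _ = (ENNReal.ofReal (π / 2) * ENNReal.ofReal (κ * R) * ENNReal.ofReal (1 + π / 2))
          * volume B * ((C * volume B) * ∫⁻ x in B, ‖fderiv ℝ f x‖ₑ) := by ring
    _ ≤ ENNReal.ofReal (2 * R) * volume B * ∫⁻ x in B, ‖fderiv ℝ f x‖ₑ := by
        rw [hCB, one_mul, ← ENNReal.ofReal_mul (by positivity), ← ENNReal.ofReal_mul (by positivity)]
        refine mul_le_mul_left (mul_le_mul_left (ENNReal.ofReal_le_ofReal ?_) _) _
        have := mul_le_mul_of_nonneg_right pi_div_two_mul_gaussian_constant_le hR.le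
        linarith

end Poincare

/-! ### Convergence of mollifications in `L¹`. -/

open Filter Topology ENNReal in
/-- A generalized dominated convergence theorem for sequences tending to zero. -/
theorem tendsto_lintegral_zero_of_le_of_tendsto {α : Type*} [MeasurableSpace α] {μ : Measure α}
    {e b : ℕ → α → ℝ≥0∞} {β : α → ℝ≥0∞} (hem : ∀ n, AEMeasurable (e n) μ)
    (hbm : ∀ n, AEMeasurable (b n) μ) (hle : ∀ n, ∀ᵐ x ∂μ, e n x ≤ b n x)
    (he : ∀ᵐ x ∂μ, Tendsto (fun n => e n x) atTop (𝓝 0))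
    (hb : ∀ᵐ x ∂μ, Tendsto (fun n => b n x) atTop (𝓝 (β x)))
    (hβm : AEMeasurable β μ) (hβ : ∫⁻ x, β x ∂μ ≠ ⊤)
    (hint : Tendsto (fun n => ∫⁻ x, b n x ∂μ) atTop (𝓝 (∫⁻ x, β x ∂μ))) :
    Tendsto (fun n => ∫⁻ x, e n x ∂μ) atTop (𝓝 0) := by
  set I := ∫⁻ x, β x ∂μ with hI
  set X : ℕ → ℝ≥0∞ := fun n => ∫⁻ x, (b n x - e n x) ∂μ with hX
  have hXadd : ∀ n, X n + ∫⁻ x, e n x ∂μ = ∫⁻ x, b n x ∂μ := by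
    intro n
    rw [hX, ← lintegral_add_right' _ (hem n)]
    exact lintegral_congr_ae ((hle n).mono fun x hx => tsub_add_cancel_of_le hx)
  -- Fatou's lemma applied to `b n - e n`, which is nonnegative and tends to `β`. Since the
  -- integrals of `b n` tend to `I`, nothing is left for `e n`.
  have hfatou : I ≤ liminf X atTop := by
    refine le_trans (lintegral_mono_ae ?_) (lintegral_liminf_le' fun n => (hbm n).sub (hem n))
    filter_upwards [he, hb, ae_lt_top' hβm hβ] with x hex hbx hx
    have := ENNReal.Tendsto.sub hbx hex (Or.inl hx.ne)
    rw [tsub_zero] at this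
    exact this.liminf_eq.ge
  rw [ENNReal.tendsto_nhds_zero]
  intro ε hε
  have hε2 : 0 < ε / 2 := ENNReal.half_pos hε.ne'
  rcases eq_or_ne ε ⊤ with rfl | hεtop
  · exact Eventually.of_forall fun n => le_top
  have hε2' : ε / 2 ≠ ⊤ := (ENNReal.div_lt_top hεtop two_ne_zero).ne
  have h1 : ∀ᶠ n in atTop, I ≤ X n + ε / 2 := by
    rcases le_or_gt I (ε / 2) with h | h
    · exact Eventually.of_forall fun n => h.trans le_add_self
    · have h2 : I - ε / 2 < liminf X atTop :=
        lt_of_lt_of_le (ENNReal.sub_lt_self hβ (hε2.trans h).ne' hε2.ne') hfatou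
      filter_upwards [eventually_lt_of_lt_liminf h2] with n hn
      exact tsub_le_iff_right.1 hn.le
  have h3 : ∀ᶠ n in atTop, ∫⁻ x, b n x ∂μ < I + ε / 2 :=
    hint.eventually_lt_const (ENNReal.lt_add_right hβ hε2.ne')
  filter_upwards [h1, h3] with n hn1 hn3
  have hXfin : X n ≠ ⊤ := by
    refine ne_top_of_le_ne_top (ENNReal.add_ne_top.2 ⟨hβ, hε2'⟩) (le_trans ?_ hn3.le)
    rw [← hXadd n]
    exact le_self_add
  rw [← ENNReal.add_le_add_iff_left hXfin, hXadd n]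
  calc ∫⁻ x, b n x ∂μ ≤ I + ε / 2 := hn3.le
    _ ≤ X n + ε / 2 + ε / 2 := by gcongr
    _ = X n + ε := by rw [add_assoc, ENNReal.add_halves]

section Mollification

variable {V : Type*} [NormedAddCommGroup V] [InnerProductSpace ℝ V] [FiniteDimensional ℝ V]
  [MeasurableSpace V] [BorelSpace V]
  {F : Type*} [NormedAddCommGroup F] [NormedSpace ℝ F] [CompleteSpace F]

open Filter Topology ENNReal ContinuousLinearMap Convolution in
/-- Mollifications of an integrable function converge to it in `L¹`. -/
theorem tendsto_lintegral_convolution_sub {φ : ℕ → ContDiffBump (0 : V)} {K : ℝ}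
    (hφ : Tendsto (fun n => (φ n).rOut) atTop (𝓝 0)) (hφK : ∀ n, (φ n).rOut ≤ K * (φ n).rIn)
    {g : V → F} (hg : Integrable g) :
    Tendsto (fun n => ∫⁻ x, ‖((φ n).normed volume ⋆[lsmul ℝ ℝ, volume] g) x - g x‖ₑ)
      atTop (𝓝 0) := by
  set A : ℕ → V → F := fun n => (φ n).normed volume ⋆[lsmul ℝ ℝ, volume] g with hA
  -- The mollification of `‖g‖` dominates that of `g`, converges almost everywhere, and has integral
  -- equal to that of `‖g‖` for every `n`. It is thus a moving majorant for dominated convergence.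
  set S : ℕ → V → ℝ := fun n => (φ n).normed volume ⋆[lsmul ℝ ℝ, volume] fun x => ‖g x‖ with hS
  have hφc : ∀ n, Continuous ((φ n).normed (volume : Measure V)) := fun n => (φ n).continuous_normed
  have hAc : ∀ n, Continuous (A n) := fun n =>
    (φ n).hasCompactSupport_normed.continuous_convolution_left _ (hφc n) hg.locallyIntegrable
  have hSc : ∀ n, Continuous (S n) := fun n =>
    (φ n).hasCompactSupport_normed.continuous_convolution_left _ (hφc n) hg.norm.locallyIntegrable
  have hA_le : ∀ n x, ‖A n x‖ ≤ S n x := by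
    intro n x
    refine (norm_integral_le_integral_norm _).trans_eq ?_
    refine integral_congr_ae (Eventually.of_forall fun t => ?_)
    simp [norm_smul, abs_of_nonneg ((φ n).nonneg_normed t)]
  have hA_le' : ∀ n x, ‖A n x‖ₑ ≤ ENNReal.ofReal (S n x) := by
    intro n x
    rw [← ofReal_norm]
    exact ENNReal.ofReal_le_ofReal (hA_le n x)
  have hSint : ∀ n, ∫⁻ x, ENNReal.ofReal (S n x) = ∫⁻ x, ‖g x‖ₑ := by
    intro n
    have hi : Integrable (S n) :=
      (φ n).integrable_normed.integrable_convolution (lsmul ℝ ℝ) hg.norm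
    rw [← ofReal_integral_eq_lintegral_ofReal hi
      (Eventually.of_forall fun x => (norm_nonneg _).trans (hA_le n x)),
      integral_convolution (lsmul ℝ ℝ) (φ n).integrable_normed hg.norm, (φ n).integral_normed]
    simp only [lsmul_apply, one_smul]
    rw [ofReal_integral_eq_lintegral_ofReal hg.norm (Eventually.of_forall fun x => norm_nonneg _)]
    simp
  have hAt := ContDiffBump.ae_convolution_tendsto_right_of_locallyIntegrable (μ := volume) hφ
    (Eventually.of_forall hφK) hg.locallyIntegrable
  have hSt := ContDiffBump.ae_convolution_tendsto_right_of_locallyIntegrable (μ := volume) hφ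
    (Eventually.of_forall hφK) hg.norm.locallyIntegrable
  have hgm : AEMeasurable (fun x => ‖g x‖ₑ) := hg.aestronglyMeasurable.enorm
  refine tendsto_lintegral_zero_of_le_of_tendsto
    (b := fun n x => ENNReal.ofReal (S n x) + ‖g x‖ₑ) (β := fun x => ‖g x‖ₑ + ‖g x‖ₑ)
    (fun n => ((hAc n).aestronglyMeasurable.sub hg.aestronglyMeasurable).enorm)
    (fun n => ((hSc n).measurable.ennreal_ofReal.aemeasurable).add hgm)
    (fun n => Eventually.of_forall fun x =>
      enorm_sub_le.trans (add_le_add_left (hA_le' n x) _)) ?_ ?_ (hgm.add hgm) ?_ ?_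
  · filter_upwards [hAt] with x hx
    have h1 := (hx.sub_const (g x)).enorm
    simpa using h1
  · filter_upwards [hSt] with x hx
    have h1 := (ENNReal.tendsto_ofReal hx)
    rw [ofReal_norm] at h1
    exact h1.add_const _
  · rw [lintegral_add_left' hgm]
    exact ENNReal.add_ne_top.2 ⟨hg.2.ne, hg.2.ne⟩
  · have h1 : ∀ n, ∫⁻ x, (ENNReal.ofReal (S n x) + ‖g x‖ₑ) = ∫⁻ x, (‖g x‖ₑ + ‖g x‖ₑ) := by
      intro n
      rw [lintegral_add_right' _ hgm, lintegral_add_right' _ hgm, hSint]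
    simp_rw [h1]
    exact tendsto_const_nhds

end Mollification

/-! ### Approximation of weakly differentiable functions by `C¹` functions. -/

section Approximation

variable {d : ℕ}

open Filter Topology in
/-- `w` and `H` are approximated on the ball of radius `r` by `C¹` functions and their gradients:
almost everywhere and in `L¹` for the functions, in `L¹` for the gradients. -/
def HasC1Approx (w : EuclideanSpace ℝ (Fin d) → ℝ)
    (H : EuclideanSpace ℝ (Fin d) → EuclideanSpace ℝ (Fin d)) (r : ℝ) : Prop :=
  ∃ f : ℕ → EuclideanSpace ℝ (Fin d) → ℝ, (∀ n, ContDiff ℝ 1 (f n)) ∧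
    (∀ᵐ x ∂volume.restrict (Metric.ball 0 r), Tendsto (fun n => f n x) atTop (𝓝 (w x))) ∧
    Tendsto (fun n => ∫⁻ x in Metric.ball 0 r, ‖f n x - w x‖ₑ) atTop (𝓝 0) ∧
    Tendsto (fun n => ∫⁻ x in Metric.ball 0 r, ‖gradient (f n) x - H x‖ₑ) atTop (𝓝 0)

open ContinuousLinearMap Convolution Metric in
/-- Mollification commutes with weak differentiation away from the boundary. -/
theorem HasWeakGradientOn.gradient_convolution {Ω : Set (EuclideanSpace ℝ (Fin d))}
    {u : EuclideanSpace ℝ (Fin d) → ℝ}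
    {G : EuclideanSpace ℝ (Fin d) → EuclideanSpace ℝ (Fin d)} (h : HasWeakGradientOn u G Ω)
    {K : Set (EuclideanSpace ℝ (Fin d))} (hK : IsCompact K) (hKΩ : K ⊆ Ω)
    (φ : ContDiffBump (0 : EuclideanSpace ℝ (Fin d))) {x : EuclideanSpace ℝ (Fin d)}
    (hx : closedBall x φ.rOut ⊆ K) :
    gradient (φ.normed volume ⋆[lsmul ℝ ℝ, volume] K.indicator u) x
      = (φ.normed volume ⋆[lsmul ℝ ℝ, volume] K.indicator G) x := by
  obtain ⟨hu, hG, hweak⟩ := h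
  set ρ : EuclideanSpace ℝ (Fin d) → ℝ := φ.normed volume with hρ
  have hρs : ContDiff ℝ ∞ ρ := φ.contDiff_normed
  have hρc : HasCompactSupport ρ := φ.hasCompactSupport_normed
  have hKm : MeasurableSet K := hK.measurableSet
  have huK : Integrable (K.indicator u) :=
    (integrable_indicator_iff hKm).2 (hu.integrableOn_compact_subset hKΩ hK)
  have hGK : Integrable (K.indicator G) :=
    (integrable_indicator_iff hKm).2 (hG.integrableOn_compact_subset hKΩ hK)
  have hzero : ∀ y, y ∉ K → x - y ∉ tsupport ρ := by
    intro y hy hy'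
    rw [hρ, φ.tsupport_normed_eq, mem_closedBall_zero_iff, ← dist_eq_norm, dist_comm] at hy'
    exact hy (hx hy')
  -- The reflected kernel, as a function of `y`, is supported in `K` and hence is a test function on
  -- `Ω`. Its derivative is minus that of `ρ`, which absorbs the sign in the weak formulation.
  set ψ : EuclideanSpace ℝ (Fin d) → ℝ := fun y => ρ (x - y) with hψ
  have hψs : ContDiff ℝ ∞ ψ := hρs.comp (contDiff_const.sub contDiff_id)
  have hψK : ∀ y, y ∉ K → ψ y = 0 := fun y hy =>
    image_eq_zero_of_notMem_tsupport (f := ρ) (hzero y hy)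
  have hψt : tsupport ψ ⊆ K := closure_minimal
    (fun y hy => by
      by_contra hyK
      exact hy (hψK y hyK)) hK.isClosed
  have hψc : HasCompactSupport ψ := hK.of_isClosed_subset (isClosed_tsupport _) hψt
  have hψd : ∀ y v, fderiv ℝ ψ y v = -fderiv ℝ ρ (x - y) v := by
    intro y v
    have h1 : HasFDerivAt (fun y : EuclideanSpace ℝ (Fin d) => x - y)
        (-ContinuousLinearMap.id ℝ _) y := (hasFDerivAt_id y).const_sub x
    have h2 := ((hρs.differentiable (by simp)) (x - y)).hasFDerivAt.comp y h1
    rw [show ψ = ρ ∘ fun y => x - y from rfl, h2.fderiv]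
    simp
  have hind : ∀ (g : EuclideanSpace ℝ (Fin d) → ℝ), (∀ y, y ∉ K → g y = 0) →
      ∫ y, g y = ∫ y in Ω, g y := by
    intro g hg
    exact (setIntegral_eq_integral_of_forall_compl_eq_zero fun y hy =>
      hg y fun hyK => hy (hKΩ hyK)).symm
  ext i
  have hd := hρc.hasFDerivAt_convolution_left (lsmul ℝ ℝ) (μ := volume)
    (hρs.of_le (by simp)) huK.locallyIntegrable x
  have hcoord : gradient (ρ ⋆[lsmul ℝ ℝ, volume] K.indicator u) x i
      = fderiv ℝ (ρ ⋆[lsmul ℝ ℝ, volume] K.indicator u) x (EuclideanSpace.single i 1) := by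
    rw [← inner_gradient_left, EuclideanSpace.inner_single_right]
    simp
  have hex : ConvolutionExists (fderiv ℝ ρ) (K.indicator u)
      ((lsmul ℝ ℝ).precompL (EuclideanSpace ℝ (Fin d))) volume :=
    (hρc.fderiv ℝ).convolutionExists_left _ (hρs.continuous_fderiv (by simp))
      huK.locallyIntegrable
  rw [hcoord, hd.fderiv, convolution_def, ContinuousLinearMap.integral_apply (hex x),
    convolution_lsmul_swap]
  have hexG : Integrable fun t => ρ (x - t) • K.indicator G t := by
    have h1 : ConvolutionExistsAt ρ (K.indicator G) x (lsmul ℝ ℝ) volume :=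
      hρc.convolutionExists_left _ hρs.continuous hGK.locallyIntegrable x
    exact (convolutionExistsAt_iff_integrable_swap.1 h1)
  have hrhs : (∫ t, ρ (x - t) • K.indicator G t) i = ∫ t, G t i * ψ t := by
    have h1 := (EuclideanSpace.proj (𝕜 := ℝ) i).integral_comp_comm hexG
    rw [show (∫ t, ρ (x - t) • K.indicator G t) i
      = (EuclideanSpace.proj (𝕜 := ℝ) i) (∫ t, ρ (x - t) • K.indicator G t) from rfl, ← h1]
    refine integral_congr_ae (Filter.Eventually.of_forall fun t => ?_)
    by_cases ht : t ∈ K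
    · simp [ht, hψ, mul_comm]
    · simp [ht, hψK t ht]
  have hlhs : ∫ t, (((lsmul ℝ ℝ).precompL (EuclideanSpace ℝ (Fin d)) (fderiv ℝ ρ t))
        (K.indicator u (x - t))) (EuclideanSpace.single i 1)
      = -∫ t, u t * fderiv ℝ ψ t (EuclideanSpace.single i 1) := by
    rw [← integral_sub_left_eq_self _ volume x, ← integral_neg]
    refine integral_congr_ae (Filter.Eventually.of_forall fun t => ?_)
    simp only [sub_sub_cancel, hψd]
    by_cases ht : t ∈ K
    · simp [ht, precompL_apply, mul_comm]
    · have h0 : fderiv ℝ ρ (x - t) = 0 :=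
        image_eq_zero_of_notMem_tsupport fun h => hzero t ht (tsupport_fderiv_subset ℝ h)
      simp [ht, h0]
  rw [hrhs, hlhs, hind (fun t => G t i * ψ t) (fun y hy => by simp [hψK y hy]),
    hind (fun t => u t * fderiv ℝ ψ t _) (fun y hy => ?_), hweak ψ hψs hψc (hψt.trans hKΩ) i,
    neg_neg]
  rw [image_eq_zero_of_notMem_tsupport (f := fderiv ℝ ψ)
    fun h => hy (hψt (tsupport_fderiv_subset ℝ h))]
  simp

-- Both `u` and `G` are cut off to a closed ball of radius `s` between `r` and `R`. Kernels of
-- radius at most `s - r` do not see the cut-off from the ball of radius `r`, so there the gradient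
-- of the mollification of `u` is the mollification of `G`.
open Filter Topology ContinuousLinearMap Convolution Metric in
theorem HasWeakGradientOn.hasC1Approx {R : ℝ} {u : EuclideanSpace ℝ (Fin d) → ℝ}
    {G : EuclideanSpace ℝ (Fin d) → EuclideanSpace ℝ (Fin d)}
    (h : HasWeakGradientOn u G (ball 0 R)) {r : ℝ} (hr : r < R) : HasC1Approx u G r := by
  obtain ⟨s, hrs, hsR⟩ := exists_between hr
  set K : Set (EuclideanSpace ℝ (Fin d)) := closedBall 0 s
  have hK : IsCompact K := isCompact_closedBall 0 s
  have hKR : K ⊆ ball 0 R := closedBall_subset_ball hsR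
  have hrK : ball 0 r ⊆ K := (ball_subset_ball hrs.le).trans ball_subset_closedBall
  have huK : Integrable (K.indicator u) :=
    (integrable_indicator_iff hK.measurableSet).2 (h.1.integrableOn_compact_subset hKR hK)
  have hGK : Integrable (K.indicator G) :=
    (integrable_indicator_iff hK.measurableSet).2 (h.2.1.integrableOn_compact_subset hKR hK)
  have hpos : ∀ n : ℕ, 0 < (s - r) / (2 * (n + 1)) := fun n =>
    div_pos (sub_pos.2 hrs) (by positivity)
  set φ : ℕ → ContDiffBump (0 : EuclideanSpace ℝ (Fin d)) := fun n =>
    -- The outer radius is `(s - r) / (n + 1)`. The fixed ratio `2` to the inner radius is what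
    -- almost everywhere convergence of the mollifications requires.
    { rIn := (s - r) / (2 * (n + 1))
      rOut := 2 * ((s - r) / (2 * (n + 1)))
      rIn_pos := hpos n
      rIn_lt_rOut := by linarith [hpos n] } with hφ
  have hout : ∀ n, (φ n).rOut = (s - r) * (1 / ((n : ℝ) + 1)) := by
    intro n
    simp only [hφ]
    field_simp
  have hφt : Tendsto (fun n => (φ n).rOut) atTop (𝓝 0) := by
    simp_rw [hout]
    simpa using (tendsto_one_div_add_atTop_nhds_zero_nat (𝕜 := ℝ)).const_mul (s - r)
  have hφle : ∀ n, (φ n).rOut ≤ s - r := by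
    intro n
    rw [hout]
    refine mul_le_of_le_one_right (sub_pos.2 hrs).le ?_
    rw [div_le_one (by positivity)]
    linarith [(Nat.cast_nonneg n : (0 : ℝ) ≤ n)]
  have hφK : ∀ n, (φ n).rOut ≤ 2 * (φ n).rIn := fun n => le_rfl
  have hmem : ∀ x ∈ ball (0 : EuclideanSpace ℝ (Fin d)) r, ∀ n, closedBall x (φ n).rOut ⊆ K := by
    intro x hx n
    refine closedBall_subset_closedBall' ?_
    have := hφle n
    rw [mem_ball] at hx
    linarith
  refine ⟨fun n => (φ n).normed volume ⋆[lsmul ℝ ℝ, volume] K.indicator u, fun n => ?_, ?_, ?_, ?_⟩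
  · exact (φ n).hasCompactSupport_normed.contDiff_convolution_left (n := 1) _
      (φ n).contDiff_normed huK.locallyIntegrable
  · have h1 := ContDiffBump.ae_convolution_tendsto_right_of_locallyIntegrable (μ := volume) hφt
      (Eventually.of_forall hφK) huK.locallyIntegrable
    rw [ae_restrict_iff' measurableSet_ball]
    filter_upwards [h1] with x hx hxr
    rwa [Set.indicator_of_mem (hrK hxr)] at hx
  · refine tendsto_of_tendsto_of_tendsto_of_le_of_le tendsto_const_nhds
      (tendsto_lintegral_convolution_sub hφt hφK huK) (fun n => zero_le) fun n => ?_
    refine le_trans (setLIntegral_mono' measurableSet_ball fun x hx => ?_)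
      (setLIntegral_le_lintegral (ball 0 r) _)
    rw [Set.indicator_of_mem (hrK hx)]
  · refine tendsto_of_tendsto_of_tendsto_of_le_of_le tendsto_const_nhds
      (tendsto_lintegral_convolution_sub hφt hφK hGK) (fun n => zero_le) fun n => ?_
    refine le_trans (setLIntegral_mono' measurableSet_ball fun x hx => ?_)
      (setLIntegral_le_lintegral (ball 0 r) _)
    rw [Set.indicator_of_mem (hrK hx),
      h.gradient_convolution hK hKR (φ n) (hmem x hx n)]

end Approximation

/-! ### Chain rule, limits and uniqueness for weak gradients. -/

section Primitive

theorem contDiff_one_intervalIntegral {h : ℝ → ℝ} (hh : Continuous h) (c : ℝ) :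
    ContDiff ℝ 1 fun s => ∫ t in c..s, h t := by
  have hd : ∀ s, HasDerivAt (fun s => ∫ t in c..s, h t) (h s) s := fun s =>
    hh.integral_hasStrictDerivAt c s |>.hasDerivAt
  rw [contDiff_one_iff_deriv]
  exact ⟨fun s => (hd s).differentiableAt, by simpa [funext fun s => (hd s).deriv] using hh⟩

theorem norm_intervalIntegral_sub_le {h : ℝ → ℝ} (hh : Continuous h) (h1 : ∀ s, ‖h s‖ ≤ 1)
    (c a b : ℝ) : ‖(∫ t in c..a, h t) - ∫ t in c..b, h t‖ ≤ ‖a - b‖ := by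
  rw [intervalIntegral.integral_interval_sub_left (hh.intervalIntegrable _ _)
    (hh.intervalIntegrable _ _)]
  simpa using intervalIntegral.norm_integral_le_of_norm_le_const (a := b) (b := a)
    (fun x _ => h1 x)

end Primitive

section Approximation

variable {d : ℕ}

open Filter Topology Metric

theorem continuous_gradient {f : EuclideanSpace ℝ (Fin d) → ℝ} (hf : ContDiff ℝ 1 f) :
    Continuous (gradient f) :=
  (LinearIsometryEquiv.continuous _).comp (hf.continuous_fderiv one_ne_zero)

/-- The chain rule for primitives of continuous functions bounded by one. -/
theorem HasC1Approx.comp_primitive {w : EuclideanSpace ℝ (Fin d) → ℝ}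
    {H : EuclideanSpace ℝ (Fin d) → EuclideanSpace ℝ (Fin d)} {r : ℝ} (hw : HasC1Approx w H r)
    (hH : IntegrableOn H (ball 0 r)) {h : ℝ → ℝ} (hh : Continuous h) (h1 : ∀ s, ‖h s‖ ≤ 1)
    (c : ℝ) : HasC1Approx (fun x => ∫ t in c..w x, h t) (fun x => h (w x) • H x) r := by
  obtain ⟨f, hf, hae, hL1, hgrad⟩ := hw
  have hΨ := contDiff_one_intervalIntegral hh c
  have hd : ∀ s, HasDerivAt (fun s => ∫ t in c..s, h t) (h s) s := fun s =>
    hh.integral_hasStrictDerivAt c s |>.hasDerivAt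
  have hg : ∀ n x, gradient (fun x => ∫ t in c..f n x, h t) x = h (f n x) • gradient (f n) x := by
    intro n x
    have h2 := (hd (f n x)).comp_hasFDerivAt x
      ((hf n).differentiable one_ne_zero x).hasFDerivAt
    rw [gradient, gradient, show (fun x => ∫ t in c..f n x, h t)
      = (fun s => ∫ t in c..s, h t) ∘ f n from rfl, h2.fderiv]
    simp
  have hwm : AEStronglyMeasurable w (volume.restrict (ball 0 r)) :=
    aestronglyMeasurable_of_tendsto_ae atTop
      (fun n => (hf n).continuous.aestronglyMeasurable) hae
  refine ⟨fun n x => ∫ t in c..f n x, h t, fun n => hΨ.comp (hf n), ?_, ?_, ?_⟩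
  · filter_upwards [hae] with x hx
    exact (hΨ.continuous.tendsto _).comp hx
  · refine tendsto_of_tendsto_of_tendsto_of_le_of_le tendsto_const_nhds hL1
      (fun n => zero_le) fun n => lintegral_mono fun x => ?_
    simp only [enorm_le_iff_norm_le]
    exact norm_intervalIntegral_sub_le hh h1 c _ _
  · have hlim : Tendsto (fun n => ∫⁻ x in ball 0 r, ‖(h (f n x) - h (w x)) • H x‖ₑ) atTop (𝓝 0) := by
      have h0 : ∫⁻ x : EuclideanSpace ℝ (Fin d) in ball 0 r, (0 : ENNReal) = 0 := by simp
      rw [← h0]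
      refine tendsto_lintegral_of_dominated_convergence' (fun x => 2 * ‖H x‖ₑ)
        (fun n => ?_) (fun n => Eventually.of_forall fun x => ?_) ?_ ?_
      · exact (((hh.comp (hf n).continuous).aestronglyMeasurable.sub
          (hh.comp_aestronglyMeasurable hwm)).smul hH.aestronglyMeasurable).enorm
      · simp only [enorm_smul]
        gcongr
        refine enorm_sub_le.trans ?_
        rw [← one_add_one_eq_two]
        have h2 : ∀ s, ‖h s‖ₑ ≤ 1 := fun s => by
          rw [← ofReal_norm, ← ENNReal.ofReal_one]
          exact ENNReal.ofReal_le_ofReal (h1 s)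
        exact add_le_add (h2 _) (h2 _)
      · rw [lintegral_const_mul' _ _ (by simp)]
        exact ENNReal.mul_ne_top (by simp) hH.2.ne
      · filter_upwards [hae] with x hx
        have h2 := ((((hh.tendsto _).comp hx).sub_const (h (w x))).smul_const (H x)).enorm
        simpa using h2
    have hsum := hgrad.add hlim
    rw [add_zero] at hsum
    refine tendsto_of_tendsto_of_tendsto_of_le_of_le tendsto_const_nhds hsum
      (fun n => zero_le) fun n => ?_
    have hm : AEMeasurable (fun x => ‖gradient (f n) x - H x‖ₑ) (volume.restrict (ball 0 r)) :=
      ((continuous_gradient (hf n)).aestronglyMeasurable.sub hH.aestronglyMeasurable).enorm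
    simp only
    rw [← lintegral_add_left' hm]
    refine lintegral_mono fun x => ?_
    rw [hg, show h (f n x) • gradient (f n) x - h (w x) • H x
      = h (f n x) • (gradient (f n) x - H x) + (h (f n x) - h (w x)) • H x by module]
    refine (enorm_add_le _ _).trans (add_le_add_left ?_ _)
    rw [enorm_le_iff_norm_le, norm_smul]
    exact mul_le_of_le_one_left (norm_nonneg _) (h1 _)

/-- The `L¹` Poincaré inequality for limits of `C¹` functions. -/
theorem HasC1Approx.lintegral_enorm_sub_le {w : EuclideanSpace ℝ (Fin d) → ℝ}
    {H : EuclideanSpace ℝ (Fin d) → EuclideanSpace ℝ (Fin d)} {r : ℝ} (hw : HasC1Approx w H r)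
    (hH : IntegrableOn H (ball 0 r)) (hd : 0 < d) (hr : 0 < r) :
    ∫⁻ x in ball 0 r, ∫⁻ y in ball 0 r, ‖w y - w x‖ₑ
      ≤ ENNReal.ofReal (2 * r) * volume (ball (0 : EuclideanSpace ℝ (Fin d)) r)
        * ∫⁻ x in ball 0 r, ‖H x‖ₑ := by
  obtain ⟨f, hf, hae, -, hgrad⟩ := hw
  set μ := volume.restrict (ball (0 : EuclideanSpace ℝ (Fin d)) r)
  set C := ENNReal.ofReal (2 * r) * volume (ball (0 : EuclideanSpace ℝ (Fin d)) r) with hC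
  have hCtop : C ≠ ⊤ := ENNReal.mul_ne_top ENNReal.ofReal_ne_top measure_ball_lt_top.ne
  have hfm : ∀ n, Measurable (f n) := fun n => (hf n).continuous.measurable
  -- Writing the integrand as a limit of continuous ones allows Fatou's lemma in each variable.
  have hpt : ∀ᵐ x ∂μ, ∀ᵐ y ∂μ, ‖w y - w x‖ₑ = liminf (fun n => ‖f n y - f n x‖ₑ) atTop := by
    filter_upwards [hae] with x hx
    filter_upwards [hae] with y hy
    exact ((hy.sub hx).enorm.liminf_eq).symm
  have hbound : ∀ n, ∫⁻ x, ∫⁻ y, ‖f n y - f n x‖ₑ ∂μ ∂μ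
      ≤ C * (∫⁻ x, ‖gradient (f n) x - H x‖ₑ ∂μ + ∫⁻ x, ‖H x‖ₑ ∂μ) := by
    intro n
    refine (lintegral_ball_enorm_sub_le (hf n) hr (by rwa [finrank_euclideanSpace_fin])).trans ?_
    refine mul_le_mul_right ?_ _
    rw [← lintegral_add_right' _ hH.aestronglyMeasurable.enorm]
    refine lintegral_mono fun x => ?_
    have h1 : ‖fderiv ℝ (f n) x‖ₑ = ‖gradient (f n) x‖ₑ := by
      rw [← ofReal_norm, ← ofReal_norm]
      exact congrArg _ (LinearIsometryEquiv.norm_map _ _).symm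
    rw [h1]
    calc ‖gradient (f n) x‖ₑ = ‖(gradient (f n) x - H x) + H x‖ₑ := by rw [sub_add_cancel]
      _ ≤ _ := enorm_add_le _ _
  have hlim : Tendsto (fun n => C * (∫⁻ x, ‖gradient (f n) x - H x‖ₑ ∂μ + ∫⁻ x, ‖H x‖ₑ ∂μ)) atTop
      (𝓝 (C * ∫⁻ x, ‖H x‖ₑ ∂μ)) := by
    have h1 := ENNReal.Tendsto.const_mul (hgrad.add_const (∫⁻ x, ‖H x‖ₑ ∂μ))
      (Or.inr hCtop)
    rwa [zero_add] at h1
  have hm2 : ∀ n, Measurable fun x => ∫⁻ y, ‖f n y - f n x‖ₑ ∂μ := by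
    intro n
    have := hfm n
    exact Measurable.lintegral_prod_right' (f := fun p : EuclideanSpace ℝ (Fin d) ×
      EuclideanSpace ℝ (Fin d) => ‖f n p.2 - f n p.1‖ₑ) (by fun_prop)
  calc ∫⁻ x, ∫⁻ y, ‖w y - w x‖ₑ ∂μ ∂μ
      ≤ ∫⁻ x, liminf (fun n => ∫⁻ y, ‖f n y - f n x‖ₑ ∂μ) atTop ∂μ := by
        refine lintegral_mono_ae ?_
        filter_upwards [hpt] with x hx
        rw [lintegral_congr_ae hx]
        exact lintegral_liminf_le fun n => ((hfm n).sub_const _).enorm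
    _ ≤ liminf (fun n => ∫⁻ x, ∫⁻ y, ‖f n y - f n x‖ₑ ∂μ ∂μ) atTop := lintegral_liminf_le hm2
    _ ≤ liminf (fun n => C * (∫⁻ x, ‖gradient (f n) x - H x‖ₑ ∂μ + ∫⁻ x, ‖H x‖ₑ ∂μ)) atTop :=
        liminf_le_liminf (Eventually.of_forall hbound)
    _ = C * ∫⁻ x, ‖H x‖ₑ ∂μ := hlim.liminf_eq

/-- Local `C¹` approximation characterizes weak gradients. -/
theorem hasWeakGradientOn_of_hasC1Approx {w : EuclideanSpace ℝ (Fin d) → ℝ}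
    {H : EuclideanSpace ℝ (Fin d) → EuclideanSpace ℝ (Fin d)} {R : ℝ}
    (hw : LocallyIntegrableOn w (ball 0 R)) (hH : LocallyIntegrableOn H (ball 0 R))
    (happ : ∀ r < R, HasC1Approx w H r) : HasWeakGradientOn w H (ball 0 R) := by
  refine ⟨hw, hH, fun φ hφ hφc hφR i => ?_⟩
  -- The support of a test function lies in a strictly smaller ball, so approximation on smaller
  -- balls suffices.
  obtain ⟨r, hrR, hφr⟩ := exists_lt_subset_ball (isClosed_tsupport φ) hφR
  obtain ⟨f, hf, -, hL1, hgrad⟩ := happ r hrR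
  set B := ball (0 : EuclideanSpace ℝ (Fin d)) r
  set e : EuclideanSpace ℝ (Fin d) := EuclideanSpace.single i 1
  have hBR : closedBall (0 : EuclideanSpace ℝ (Fin d)) r ⊆ ball 0 R := closedBall_subset_ball hrR
  have hwB : IntegrableOn w B :=
    (hw.integrableOn_compact_subset hBR (isCompact_closedBall 0 r)).mono_set ball_subset_closedBall
  have hHB : IntegrableOn H B :=
    (hH.integrableOn_compact_subset hBR (isCompact_closedBall 0 r)).mono_set ball_subset_closedBall
  have hφ0 : ∀ x, x ∉ B → φ x = 0 := fun x hx =>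
    image_eq_zero_of_notMem_tsupport fun h => hx (hφr h)
  have hφ0' : ∀ x, x ∉ B → fderiv ℝ φ x e = 0 := fun x hx => by
    rw [image_eq_zero_of_notMem_tsupport (f := fderiv ℝ φ)
      fun h => hx (hφr (tsupport_fderiv_subset ℝ h))]
    rfl
  have hφd : Continuous fun x => fderiv ℝ φ x e :=
    (hφ.continuous_fderiv (by simp)).clm_apply continuous_const
  obtain ⟨C₀, hC₀⟩ := hφc.exists_bound_of_continuous hφ.continuous
  have hφdc : HasCompactSupport fun x => fderiv ℝ φ x e :=
    (hφc.fderiv ℝ).comp_left (g := fun L : EuclideanSpace ℝ (Fin d) →L[ℝ] ℝ => L e) rfl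
  obtain ⟨C₁, hC₁⟩ := hφdc.exists_bound_of_continuous hφd
  have hset : ∀ g : EuclideanSpace ℝ (Fin d) → ℝ, (∀ x, x ∉ B → g x = 0) →
      ∫ x in ball 0 R, g x = ∫ x in B, g x := by
    intro g hg
    rw [setIntegral_eq_integral_of_forall_compl_eq_zero (s := B) hg,
      setIntegral_eq_integral_of_forall_compl_eq_zero fun x hx =>
        hg x fun hxB => hx (ball_subset_ball hrR.le hxB)]
  have hcomp : ∀ g : EuclideanSpace ℝ (Fin d) → ℝ, Continuous g → ∀ {ψ : EuclideanSpace ℝ (Fin d) → ℝ},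
      Continuous ψ → HasCompactSupport ψ → Integrable fun x => g x * ψ x :=
    fun g hg ψ hψ hψc => (hg.mul hψ).integrable_of_hasCompactSupport hψc.mul_left
  have hfd : ∀ n, Continuous fun x => fderiv ℝ (f n) x e := fun n =>
    ((hf n).continuous_fderiv one_ne_zero).clm_apply continuous_const
  have hparts : ∀ n, ∫ x in B, f n x * fderiv ℝ φ x e = -∫ x in B, fderiv ℝ (f n) x e * φ x := by
    intro n
    rw [setIntegral_eq_integral_of_forall_compl_eq_zero fun x hx => by rw [hφ0' x hx, mul_zero],
      setIntegral_eq_integral_of_forall_compl_eq_zero fun x hx => by rw [hφ0 x hx, mul_zero]]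
    exact integral_mul_fderiv_eq_neg_fderiv_mul_of_integrable
      (hcomp _ (hfd n) hφ.continuous hφc) (hcomp _ (hf n).continuous hφd hφdc)
      (hcomp _ (hf n).continuous hφ.continuous hφc)
      (fun x _ => (hf n).differentiable one_ne_zero x) fun x _ => hφ.differentiable (by simp) x
  have hmul : ∀ (a b : ℝ) (C : ℝ), ‖b‖ ≤ C → ‖a * b‖ₑ ≤ ENNReal.ofReal C * ‖a‖ₑ := by
    intro a b C hb
    rw [enorm_mul, mul_comm]
    gcongr
    rw [← ofReal_norm]
    exact ENNReal.ofReal_le_ofReal hb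
  have hlim1 : Tendsto (fun n => ∫ x in B, f n x * fderiv ℝ φ x e) atTop
      (𝓝 (∫ x in B, w x * fderiv ℝ φ x e)) := by
    refine tendsto_integral_of_L1 _ (hwB.aestronglyMeasurable.mul hφd.aestronglyMeasurable)
      (Eventually.of_forall fun n => (hcomp _ (hf n).continuous hφd hφdc).integrableOn) ?_
    have h1 := ENNReal.Tendsto.const_mul hL1 (Or.inr (ENNReal.ofReal_ne_top (r := C₁)))
    rw [mul_zero] at h1
    refine tendsto_of_tendsto_of_tendsto_of_le_of_le tendsto_const_nhds h1
      (fun n => zero_le) fun n => ?_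
    rw [← lintegral_const_mul' _ _ ENNReal.ofReal_ne_top]
    refine lintegral_mono fun x => ?_
    simp only [Pi.mul_apply]
    rw [← sub_mul]
    exact hmul _ _ _ (hC₁ x)
  have hcoord : ∀ n x, fderiv ℝ (f n) x e = gradient (f n) x i := by
    intro n x
    rw [← inner_gradient_left, EuclideanSpace.inner_single_right]
    simp
  have hlim2 : Tendsto (fun n => ∫ x in B, fderiv ℝ (f n) x e * φ x) atTop
      (𝓝 (∫ x in B, H x i * φ x)) := by
    have hHi : AEStronglyMeasurable (fun x => H x i) (volume.restrict B) :=
      (EuclideanSpace.proj (𝕜 := ℝ) i).continuous.comp_aestronglyMeasurable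
        hHB.aestronglyMeasurable
    refine tendsto_integral_of_L1 _ (hHi.mul hφ.continuous.aestronglyMeasurable)
      (Eventually.of_forall fun n => (hcomp _ (hfd n) hφ.continuous hφc).integrableOn) ?_
    have h1 := ENNReal.Tendsto.const_mul hgrad (Or.inr (ENNReal.ofReal_ne_top (r := C₀)))
    rw [mul_zero] at h1
    refine tendsto_of_tendsto_of_tendsto_of_le_of_le tendsto_const_nhds h1
      (fun n => zero_le) fun n => ?_
    rw [← lintegral_const_mul' _ _ ENNReal.ofReal_ne_top]
    refine lintegral_mono fun x => ?_
    simp only [Pi.mul_apply]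
    rw [← sub_mul, hcoord]
    refine (hmul _ _ _ (hC₀ x)).trans (mul_le_mul_right ?_ _)
    rw [enorm_le_iff_norm_le]
    exact PiLp.norm_apply_le (gradient (f n) x - H x) i
  rw [hset _ fun x hx => by rw [hφ0' x hx, mul_zero],
    hset _ fun x hx => by rw [hφ0 x hx, mul_zero]]
  simp_rw [hparts] at hlim1
  exact tendsto_nhds_unique hlim1 hlim2.neg

/-- Weak gradients pass to dominated limits. -/
theorem HasWeakGradientOn.of_tendsto {Ω : Set (EuclideanSpace ℝ (Fin d))}
    {w : ℕ → EuclideanSpace ℝ (Fin d) → ℝ}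
    {H : ℕ → EuclideanSpace ℝ (Fin d) → EuclideanSpace ℝ (Fin d)}
    {w' : EuclideanSpace ℝ (Fin d) → ℝ}
    {H' : EuclideanSpace ℝ (Fin d) → EuclideanSpace ℝ (Fin d)}
    {a b : EuclideanSpace ℝ (Fin d) → ℝ} (ha : IntegrableOn a Ω) (hb : IntegrableOn b Ω)
    (hw : ∀ n, HasWeakGradientOn (w n) (H n) Ω)
    (hwm : ∀ n, AEStronglyMeasurable (w n) (volume.restrict Ω))
    (hHm : ∀ n, AEStronglyMeasurable (H n) (volume.restrict Ω))
    (hwa : ∀ n x, ‖w n x‖ ≤ a x) (hHb : ∀ n x, ‖H n x‖ ≤ b x)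
    (hwt : ∀ x, Tendsto (fun n => w n x) atTop (𝓝 (w' x)))
    (hHt : ∀ x, Tendsto (fun n => H n x) atTop (𝓝 (H' x))) :
    HasWeakGradientOn w' H' Ω := by
  have hwi : IntegrableOn w' Ω := ha.mono'
    (aestronglyMeasurable_of_tendsto_ae atTop hwm (Eventually.of_forall hwt))
    (Eventually.of_forall fun x => le_of_tendsto (hwt x).norm
      (Eventually.of_forall fun n => hwa n x))
  have hHi : IntegrableOn H' Ω := hb.mono'
    (aestronglyMeasurable_of_tendsto_ae atTop hHm (Eventually.of_forall hHt))
    (Eventually.of_forall fun x => le_of_tendsto (hHt x).norm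
      (Eventually.of_forall fun n => hHb n x))
  refine ⟨hwi.locallyIntegrableOn, hHi.locallyIntegrableOn, fun φ hφ hφc hφΩ i => ?_⟩
  set e : EuclideanSpace ℝ (Fin d) := EuclideanSpace.single i 1
  have hφd : Continuous fun x => fderiv ℝ φ x e :=
    (hφ.continuous_fderiv (by simp)).clm_apply continuous_const
  have hφdc : HasCompactSupport fun x => fderiv ℝ φ x e :=
    (hφc.fderiv ℝ).comp_left (g := fun L : EuclideanSpace ℝ (Fin d) →L[ℝ] ℝ => L e) rfl
  obtain ⟨C₀, hC₀⟩ := hφc.exists_bound_of_continuous hφ.continuous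
  obtain ⟨C₁, hC₁⟩ := hφdc.exists_bound_of_continuous hφd
  have hlim1 : Tendsto (fun n => ∫ x in Ω, w n x * fderiv ℝ φ x e) atTop
      (𝓝 (∫ x in Ω, w' x * fderiv ℝ φ x e)) := by
    refine tendsto_integral_of_dominated_convergence (fun x => a x * C₁)
      (fun n => (hwm n).mul hφd.aestronglyMeasurable) (ha.mul_const C₁)
      (fun n => Eventually.of_forall fun x => ?_)
      (Eventually.of_forall fun x => (hwt x).mul_const _)
    rw [norm_mul]
    exact mul_le_mul (hwa n x) (hC₁ x) (norm_nonneg _) ((norm_nonneg _).trans (hwa n x))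
  have hlim2 : Tendsto (fun n => ∫ x in Ω, H n x i * φ x) atTop (𝓝 (∫ x in Ω, H' x i * φ x)) := by
    refine tendsto_integral_of_dominated_convergence (fun x => b x * C₀)
      (fun n => ((EuclideanSpace.proj (𝕜 := ℝ) i).continuous.comp_aestronglyMeasurable
        (hHm n)).mul hφ.continuous.aestronglyMeasurable) (hb.mul_const C₀)
      (fun n => Eventually.of_forall fun x => ?_)
      (Eventually.of_forall fun x =>
        (((EuclideanSpace.proj (𝕜 := ℝ) i).continuous.tendsto _).comp (hHt x)).mul_const _)
    rw [norm_mul]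
    exact mul_le_mul ((PiLp.norm_apply_le _ i).trans (hHb n x)) (hC₀ x) (norm_nonneg _)
      ((norm_nonneg _).trans (hHb n x))
  have hpart : ∀ n, ∫ x in Ω, w n x * fderiv ℝ φ x e = -∫ x in Ω, H n x i * φ x :=
    fun n => (hw n).2.2 φ hφ hφc hφΩ i
  simp_rw [hpart] at hlim1
  exact tendsto_nhds_unique hlim1 hlim2.neg

/-- Weak gradients on open sets are unique up to null sets. -/
theorem HasWeakGradientOn.ae_eq {Ω : Set (EuclideanSpace ℝ (Fin d))} (hΩ : IsOpen Ω)
    {w : EuclideanSpace ℝ (Fin d) → ℝ}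
    {G H : EuclideanSpace ℝ (Fin d) → EuclideanSpace ℝ (Fin d)} (hG : HasWeakGradientOn w G Ω)
    (hH : HasWeakGradientOn w H Ω) : G =ᵐ[volume.restrict Ω] H := by
  have hcoord : ∀ i, ∀ᵐ x, x ∈ Ω → G x i - H x i = 0 := by
    intro i
    have hloc : ∀ {F : EuclideanSpace ℝ (Fin d) → EuclideanSpace ℝ (Fin d)},
        LocallyIntegrableOn F Ω → LocallyIntegrableOn (fun x => F x i) Ω := by
      intro F hF x hx
      obtain ⟨s, hs, hFs⟩ := hF x hx
      exact ⟨s, hs, (EuclideanSpace.proj (𝕜 := ℝ) i).integrable_comp hFs⟩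
    refine hΩ.ae_eq_zero_of_integral_contDiff_smul_eq_zero
      ((hloc hG.2.1).sub (hloc hH.2.1)) fun φ hφ hφc hφΩ => ?_
    have hint : ∀ {F : EuclideanSpace ℝ (Fin d) → EuclideanSpace ℝ (Fin d)},
        LocallyIntegrableOn F Ω → IntegrableOn (fun x => F x i * φ x) Ω := by
      intro F hF
      have h1 : IntegrableOn (fun x => F x i) (tsupport φ) :=
        (hloc hF).integrableOn_compact_subset hφΩ hφc
      have h2 : IntegrableOn (fun x => F x i * φ x) (tsupport φ) :=
        h1.mul_continuousOn hφ.continuous.continuousOn hφc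
      refine h2.of_forall_sdiff_eq_zero hΩ.measurableSet fun x hx => ?_
      rw [image_eq_zero_of_notMem_tsupport hx.2, mul_zero]
    have h3 : ∫ x, φ x • (G x i - H x i) = ∫ x in Ω, (G x i * φ x - H x i * φ x) := by
      rw [setIntegral_eq_integral_of_forall_compl_eq_zero]
      · refine integral_congr_ae (Eventually.of_forall fun x => ?_)
        simp only [smul_eq_mul]
        ring
      · intro x hx
        rw [image_eq_zero_of_notMem_tsupport fun h => hx (hφΩ h)]
        ring
    have h4 := hG.2.2 φ hφ hφc hφΩ i
    have h5 := hH.2.2 φ hφ hφc hφΩ i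
    rw [h3, integral_sub (hint hG.2.1) (hint hH.2.1)]
    linarith
  rw [Filter.EventuallyEq, ae_restrict_iff' hΩ.measurableSet]
  filter_upwards [ae_all_iff.2 hcoord] with x hx hxΩ
  ext i
  exact sub_eq_zero.1 (hx i hxΩ)

end Approximation

/-! ### Truncation and the level set inequality with the gradient in `L¹`. -/

section Truncation

open Filter Topology Metric Set

variable {d : ℕ}

/-- Truncation from below preserves weak differentiability. -/
theorem HasWeakGradientOn.max_sub_zero {R : ℝ} {u : EuclideanSpace ℝ (Fin d) → ℝ}
    {G : EuclideanSpace ℝ (Fin d) → EuclideanSpace ℝ (Fin d)}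
    (h : HasWeakGradientOn u G (ball 0 R)) (hu : IntegrableOn u (ball 0 R))
    (hG : IntegrableOn G (ball 0 R)) (k : ℝ) :
    HasWeakGradientOn (fun x => max (u x - k) 0) ({x | k < u x}.indicator G) (ball 0 R) := by
  -- Continuous approximations of the indicator of `(k, ∞)`. They vanish at `k`, so the limiting
  -- gradient is zero on `{u = k}` and convergence holds at every point.
  set g : ℕ → ℝ → ℝ := fun n s => max 0 (min 1 (n * (s - k))) with hg
  have hgc : ∀ n, Continuous (g n) := fun n => by
    simp only [hg]
    fun_prop
  have hg1 : ∀ n s, ‖g n s‖ ≤ 1 := by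
    intro n s
    rw [Real.norm_eq_abs, abs_of_nonneg (le_max_left _ _)]
    exact max_le zero_le_one (min_le_left _ _)
  have hg0 : ∀ n s, s ≤ k → g n s = 0 := by
    intro n s hs
    refine max_eq_left ((min_le_right _ _).trans ?_)
    exact mul_nonpos_of_nonneg_of_nonpos (Nat.cast_nonneg n) (sub_nonpos.2 hs)
  have hgt : ∀ s, k < s → Tendsto (fun n => g n s) atTop (𝓝 1) := by
    intro s hs
    have h1 : Tendsto (fun n : ℕ => (n : ℝ) * (s - k)) atTop atTop :=
      tendsto_natCast_atTop_atTop.atTop_mul_const (sub_pos.2 hs)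
    refine tendsto_const_nhds.congr' ?_
    filter_upwards [h1.eventually_ge_atTop 1] with n hn
    simp only [hg]
    rw [min_eq_left hn, max_eq_right zero_le_one]
  have hΨb : ∀ n s, ‖∫ t in k..s, g n t‖ ≤ ‖s - k‖ := by
    intro n s
    simpa using norm_intervalIntegral_sub_le (hgc n) (hg1 n) k s k
  have hΨt : ∀ s, Tendsto (fun n => ∫ t in k..s, g n t) atTop (𝓝 (max (s - k) 0)) := by
    intro s
    rcases le_or_gt s k with hs | hs
    · rw [max_eq_right (sub_nonpos.2 hs)]
      refine tendsto_const_nhds.congr fun n => ?_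
      rw [intervalIntegral.integral_congr (g := fun _ => (0 : ℝ)), intervalIntegral.integral_zero]
      intro t ht
      rw [uIcc_of_ge hs] at ht
      exact hg0 n t ht.2
    · rw [max_eq_left (sub_pos.2 hs).le]
      have h1 : s - k = ∫ _ in k..s, (1 : ℝ) := by simp
      rw [h1]
      refine intervalIntegral.tendsto_integral_filter_of_dominated_convergence (fun _ => 1)
        (Eventually.of_forall fun n => (hgc n).aestronglyMeasurable)
        (Eventually.of_forall fun n => Eventually.of_forall fun t _ => hg1 n t)
        intervalIntegrable_const (Eventually.of_forall fun t ht => ?_)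
      rw [uIoc_of_le hs.le] at ht
      exact hgt t ht.1
  have hfin : volume (ball (0 : EuclideanSpace ℝ (Fin d)) R) ≠ ⊤ := measure_ball_lt_top.ne
  have huk : IntegrableOn (fun x => ‖u x - k‖) (ball 0 R) :=
    (hu.sub (integrableOn_const hfin)).norm
  have hwm : ∀ n, AEStronglyMeasurable (fun x => ∫ t in k..u x, g n t)
      (volume.restrict (ball 0 R)) := fun n =>
    (contDiff_one_intervalIntegral (hgc n) k).continuous.comp_aestronglyMeasurable
      hu.aestronglyMeasurable
  have hHm : ∀ n, AEStronglyMeasurable (fun x => g n (u x) • G x)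
      (volume.restrict (ball 0 R)) := fun n =>
    ((hgc n).comp_aestronglyMeasurable hu.aestronglyMeasurable).smul hG.aestronglyMeasurable
  have hHb : ∀ n x, ‖g n (u x) • G x‖ ≤ ‖G x‖ := by
    intro n x
    rw [norm_smul]
    exact mul_le_of_le_one_left (norm_nonneg _) (hg1 n _)
  refine HasWeakGradientOn.of_tendsto (w := fun n x => ∫ t in k..u x, g n t)
    (H := fun n x => g n (u x) • G x) huk hG.norm (fun n => ?_) hwm hHm
    (fun n x => hΨb n _) hHb (fun x => hΨt _) fun x => ?_
  · refine hasWeakGradientOn_of_hasC1Approx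
      (IntegrableOn.locallyIntegrableOn
        (huk.mono' (hwm n) (Eventually.of_forall fun x => hΨb n _)))
      (IntegrableOn.locallyIntegrableOn
        (hG.norm.mono' (hHm n) (Eventually.of_forall fun x => hHb n x)))
      fun r hr => ?_
    exact (h.hasC1Approx hr).comp_primitive (hG.mono_set (ball_subset_ball hr.le)) (hgc n)
      (hg1 n) k
  · by_cases hx : k < u x
    · rw [indicator_of_mem (show x ∈ {x | k < u x} from hx)]
      simpa using (hgt _ hx).smul_const (G x)
    · rw [indicator_of_notMem (show x ∉ {x | k < u x} from hx)]
      simp [hg0 _ _ (not_lt.1 hx)]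

/-- De Giorgi's isoperimetric inequality for level sets, with the gradient in `L¹`. -/
theorem HasWeakGradientOn.mul_measure_level_sets_le {R : ℝ} (hd : 0 < d)
    {w : EuclideanSpace ℝ (Fin d) → ℝ}
    {G : EuclideanSpace ℝ (Fin d) → EuclideanSpace ℝ (Fin d)}
    (h : HasWeakGradientOn w G (ball 0 R)) (hG : IntegrableOn G (ball 0 R)) {L : ℝ} (hL : 0 < L) :
    ENNReal.ofReal L * volume ({x | w x ≤ 0} ∩ ball 0 R) * volume ({x | L ≤ w x} ∩ ball 0 R)
      ≤ ENNReal.ofReal R * volume (ball (0 : EuclideanSpace ℝ (Fin d)) R) *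
        ∫⁻ x in ball 0 R, {x | 0 < w x ∧ w x < L}.indicator (fun x => ‖G x‖ₑ) x := by
  set Q := ∫⁻ x in ball 0 R, {x | 0 < w x ∧ w x < L}.indicator (fun x => ‖G x‖ₑ) x
  set C := ENNReal.ofReal R * volume (ball (0 : EuclideanSpace ℝ (Fin d)) R) * Q
  -- Continuous approximations of the indicator of `(0, L)`, zero outside it. Their primitives are
  -- constant on either side, `0` below and `M n` above, with `M n` tending to `L`.
  set g : ℕ → ℝ → ℝ := fun n s => max 0 (min 1 (n * min s (L - s))) with hg
  have hgc : ∀ n, Continuous (g n) := fun n => by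
    simp only [hg]
    fun_prop
  have hgpos : ∀ n s, 0 ≤ g n s := fun n s => le_max_left _ _
  have hg1 : ∀ n s, ‖g n s‖ ≤ 1 := by
    intro n s
    rw [Real.norm_eq_abs, abs_of_nonneg (hgpos n s)]
    exact max_le zero_le_one (min_le_left _ _)
  have hg0 : ∀ n s, ¬(0 < s ∧ s < L) → g n s = 0 := by
    intro n s hs
    refine max_eq_left ((min_le_right _ _).trans ?_)
    refine mul_nonpos_of_nonneg_of_nonpos (Nat.cast_nonneg n) ?_
    rw [min_le_iff]
    by_contra! hcon
    exact hs ⟨hcon.1, sub_pos.1 hcon.2⟩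
  have hgt : ∀ s, 0 < s → s < L → Tendsto (fun n => g n s) atTop (𝓝 1) := by
    intro s hs hsL
    have h1 : Tendsto (fun n : ℕ => (n : ℝ) * min s (L - s)) atTop atTop :=
      tendsto_natCast_atTop_atTop.atTop_mul_const (lt_min hs (sub_pos.2 hsL))
    refine tendsto_const_nhds.congr' ?_
    filter_upwards [h1.eventually_ge_atTop 1] with n hn
    simp only [hg]
    rw [min_eq_left hn, max_eq_right zero_le_one]
  set M : ℕ → ℝ := fun n => ∫ t in (0 : ℝ)..L, g n t with hM
  have hM0 : ∀ n, 0 ≤ M n := fun n =>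
    intervalIntegral.integral_nonneg hL.le fun t _ => hgpos n t
  have hMt : Tendsto M atTop (𝓝 L) := by
    have h1 : L = ∫ _ in (0 : ℝ)..L, (1 : ℝ) := by simp
    conv => rw [h1]
    refine intervalIntegral.tendsto_integral_filter_of_dominated_convergence (fun _ => 1)
      (Eventually.of_forall fun n => (hgc n).aestronglyMeasurable)
      (Eventually.of_forall fun n => Eventually.of_forall fun t _ => hg1 n t)
      intervalIntegrable_const ?_
    -- The half-open interval of integration contains `L`, where every `g n` vanishes; this point is
    -- discarded as a null set.
    have h2 : ∀ᵐ t : ℝ, t ≠ L := by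
      rw [ae_iff]
      simp
    filter_upwards [h2] with t htL ht
    rw [uIoc_of_le hL.le] at ht
    exact hgt t ht.1 (lt_of_le_of_ne ht.2 htL)
  have hlow : ∀ n s, s ≤ 0 → ∫ t in (0 : ℝ)..s, g n t = 0 := by
    intro n s hs
    rw [intervalIntegral.integral_congr (g := fun _ => (0 : ℝ)), intervalIntegral.integral_zero]
    intro t ht
    rw [uIcc_of_ge hs] at ht
    exact hg0 n t fun h => absurd h.1 (not_lt.2 ht.2)
  have hhigh : ∀ n s, L ≤ s → ∫ t in (0 : ℝ)..s, g n t = M n := by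
    intro n s hs
    have h1 : ∫ t in L..s, g n t = 0 := by
      rw [intervalIntegral.integral_congr (g := fun _ => (0 : ℝ)), intervalIntegral.integral_zero]
      intro t ht
      rw [uIcc_of_le hs] at ht
      exact hg0 n t fun h => absurd h.2 (not_lt.2 ht.1)
    rw [hM, ← intervalIntegral.integral_add_adjacent_intervals
      ((hgc n).intervalIntegrable 0 L) ((hgc n).intervalIntegrable L s), h1, add_zero]
  have hlocal : ∀ r < R, ∀ n, ENNReal.ofReal (M n) * volume ({x | w x ≤ 0} ∩ ball 0 r)
      * volume ({x | L ≤ w x} ∩ ball 0 r) ≤ C := by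
    intro r hr n
    rcases le_or_gt r 0 with hr0 | hr0
    · rw [ball_eq_empty.2 hr0]
      simp
    have hGr : IntegrableOn G (ball 0 r) := hG.mono_set (ball_subset_ball hr.le)
    have happ := (h.hasC1Approx hr).comp_primitive hGr (hgc n) (hg1 n) 0
    have hwm : AEMeasurable w (volume.restrict (ball 0 r)) :=
      (((h.1.mono_set (ball_subset_ball hr.le))).aestronglyMeasurable).aemeasurable
    have hHi : IntegrableOn (fun x => g n (w x) • G x) (ball 0 r) := by
      refine hGr.norm.mono' (((hgc n).comp_aestronglyMeasurable
        hwm.aestronglyMeasurable).smul hGr.aestronglyMeasurable) (Eventually.of_forall fun x => ?_)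
      rw [norm_smul]
      exact mul_le_of_le_one_left (norm_nonneg _) (hg1 n _)
    have hmain := happ.lintegral_enorm_sub_le hHi hd hr0
    rw [← Measure.restrict_apply' measurableSet_ball, ← Measure.restrict_apply' measurableSet_ball]
    set μ := volume.restrict (ball (0 : EuclideanSpace ℝ (Fin d)) r)
    set A := {x | w x ≤ 0}
    set D := {x | L ≤ w x}
    have hA : NullMeasurableSet A μ := hwm.nullMeasurableSet_preimage measurableSet_Iic
    have hD : NullMeasurableSet D μ := hwm.nullMeasurableSet_preimage measurableSet_Ici
    have hm : ‖M n‖ₑ = ENNReal.ofReal (M n) := Real.enorm_of_nonneg (hM0 n)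
    have hinner : ∀ x, A.indicator (fun _ => ENNReal.ofReal (M n) * μ D) x
        + D.indicator (fun _ => ENNReal.ofReal (M n) * μ A) x
        ≤ ∫⁻ y, ‖(∫ t in (0 : ℝ)..w y, g n t) - ∫ t in (0 : ℝ)..w x, g n t‖ₑ ∂μ := by
      intro x
      by_cases hxA : x ∈ A
      · have hxD : x ∉ D := fun hxD => absurd (le_trans hxD hxA) (not_le.2 hL)
        rw [indicator_of_mem hxA, indicator_of_notMem hxD, add_zero, hlow n _ hxA,
          ← lintegral_indicator_const₀ hD]
        refine lintegral_mono fun y => ?_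
        by_cases hy : y ∈ D
        · simp only [indicator_of_mem hy, hhigh n _ hy, sub_zero, hm, le_refl]
        · simp [indicator_of_notMem hy]
      · rw [indicator_of_notMem hxA, zero_add]
        by_cases hxD : x ∈ D
        · rw [indicator_of_mem hxD, hhigh n _ hxD, ← lintegral_indicator_const₀ hA]
          refine lintegral_mono fun y => ?_
          by_cases hy : y ∈ A
          · simp only [indicator_of_mem hy, hlow n _ hy, zero_sub, enorm_neg, hm, le_refl]
          · simp [indicator_of_notMem hy]
        · simp [indicator_of_notMem hxD]
    -- Pairs in `A × D` and in `D × A` contribute equally. This factor `2` cancels the one in the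
    -- Poincaré constant.
    have hlower : 2 * (ENNReal.ofReal (M n) * μ A * μ D)
        ≤ ∫⁻ x, ∫⁻ y, ‖(∫ t in (0 : ℝ)..w y, g n t) - ∫ t in (0 : ℝ)..w x, g n t‖ₑ ∂μ ∂μ := by
      refine le_trans (le_of_eq ?_) (lintegral_mono hinner)
      rw [lintegral_add_left' (aemeasurable_const.indicator₀ hA), lintegral_indicator_const₀ hA,
        lintegral_indicator_const₀ hD]
      ring
    have hupper : ∫⁻ x, ‖g n (w x) • G x‖ₑ ∂μ ≤ Q := by
      refine le_trans (lintegral_mono fun x => ?_)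
        (lintegral_mono_set (ball_subset_ball hr.le))
      by_cases hx : x ∈ {x | 0 < w x ∧ w x < L}
      · rw [indicator_of_mem hx, enorm_le_iff_norm_le, norm_smul]
        exact mul_le_of_le_one_left (norm_nonneg _) (hg1 n _)
      · simp [hg0 n _ hx]
    have hfinal : 2 * (ENNReal.ofReal (M n) * μ A * μ D) ≤ 2 * C := by
      refine (hlower.trans hmain).trans ?_
      calc ENNReal.ofReal (2 * r) * volume (ball (0 : EuclideanSpace ℝ (Fin d)) r)
            * ∫⁻ x, ‖g n (w x) • G x‖ₑ ∂μ
          ≤ ENNReal.ofReal (2 * R) * volume (ball (0 : EuclideanSpace ℝ (Fin d)) R) * Q := by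
            gcongr
        _ = 2 * C := by
            rw [ENNReal.ofReal_mul zero_le_two, ENNReal.ofReal_ofNat]
            simp only [C]
            ring
    exact (ENNReal.mul_le_mul_iff_right two_ne_zero ENNReal.ofNat_ne_top).1 hfinal
  have hlocal' : ∀ r < R, ENNReal.ofReal L * volume ({x | w x ≤ 0} ∩ ball 0 r)
      * volume ({x | L ≤ w x} ∩ ball 0 r) ≤ C := by
    intro r hr
    have hfin : ∀ S : Set (EuclideanSpace ℝ (Fin d)), volume (S ∩ ball 0 r) ≠ ⊤ := fun S =>
      measure_ne_top_of_subset inter_subset_right measure_ball_lt_top.ne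
    exact le_of_tendsto' (ENNReal.Tendsto.mul_const (ENNReal.Tendsto.mul_const
      (ENNReal.tendsto_ofReal hMt) (Or.inr (hfin _))) (Or.inr (hfin _))) (hlocal r hr)
  -- Approximation is available only on smaller balls; exhausting the full ball gives the result by
  -- continuity of measure.
  obtain ⟨ρ, hρm, hρR, hρt⟩ := exists_seq_strictMono_tendsto R
  have hcont : ∀ S : Set (EuclideanSpace ℝ (Fin d)),
      Tendsto (fun m => volume (S ∩ ball 0 (ρ m))) atTop (𝓝 (volume (S ∩ ball 0 R))) := by
    intro S
    have hU : S ∩ ball 0 R = ⋃ m, S ∩ ball 0 (ρ m) := by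
      rw [← inter_iUnion]
      congr 1
      ext x
      simp only [mem_iUnion, mem_ball_zero_iff]
      constructor
      · intro hx
        exact (hρt.eventually_const_lt hx).exists
      · rintro ⟨m, hm⟩
        exact hm.trans (hρR m)
    rw [hU]
    exact tendsto_measure_iUnion_atTop fun m m' hmm =>
      inter_subset_inter_right _ (ball_subset_ball (hρm.monotone hmm))
  have hfin : ∀ S : Set (EuclideanSpace ℝ (Fin d)), volume (S ∩ ball 0 R) ≠ ⊤ := fun S =>
    measure_ne_top_of_subset inter_subset_right measure_ball_lt_top.ne
  refine le_of_tendsto' (ENNReal.Tendsto.mul (ENNReal.Tendsto.const_mul (hcont _)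
    (Or.inr ENNReal.ofReal_ne_top)) (Or.inr (hfin _)) (hcont _) (Or.inr ?_))
    fun m => hlocal' (ρ m) (hρR m)
  exact ENNReal.mul_ne_top ENNReal.ofReal_ne_top (hfin _)

theorem MemH1.max_sub_zero {R : ℝ} {u : EuclideanSpace ℝ (Fin d) → ℝ}
    (hu : MemH1 u (ball 0 R)) (k : ℝ) : MemH1 (fun x => max (u x - k) 0) (ball 0 R) := by
  obtain ⟨hu2, G, hG, hG2⟩ := hu
  have hfin : IsFiniteMeasure (volume.restrict (ball (0 : EuclideanSpace ℝ (Fin d)) R)) :=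
    ⟨by simpa using measure_ball_lt_top⟩
  have hw := hG.max_sub_zero (hu2.integrable one_le_two) (hG2.integrable one_le_two) k
  refine ⟨?_, _, hw, ?_⟩
  · refine (hu2.sub (memLp_const k)).mono hw.1.aestronglyMeasurable
      (Eventually.of_forall fun x => ?_)
    rw [Real.norm_eq_abs, abs_of_nonneg (le_max_right _ _)]
    exact max_le (le_abs_self _) (norm_nonneg _)
  · exact hG2.mono hw.2.1.aestronglyMeasurable
      (Eventually.of_forall fun x => norm_indicator_le_norm_self _ _)

/-- The Cauchy–Schwarz inequality for the integral of a norm over a subset. -/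
theorem lintegral_indicator_enorm_le {α F : Type*} [MeasurableSpace α] [NormedAddCommGroup F]
    {μ : Measure α} {G : α → F} (hG : MemLp G 2 μ) {S : Set α} (hS : NullMeasurableSet S μ) :
    ∫⁻ x, S.indicator (fun x => ‖G x‖ₑ) x ∂μ
      ≤ μ S ^ (1 / 2 : ℝ) * ENNReal.ofReal √(∫ x, ‖G x‖ ^ 2 ∂μ) := by
  have hsq : ∫⁻ x, ‖G x‖ₑ ^ (2 : ℝ) ∂μ = ENNReal.ofReal (∫ x, ‖G x‖ ^ 2 ∂μ) := by
    rw [ofReal_integral_eq_lintegral_ofReal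
      ((memLp_two_iff_integrable_sq_norm hG.aestronglyMeasurable).1 hG)
      (Eventually.of_forall fun x => sq_nonneg _)]
    refine lintegral_congr fun x => ?_
    rw [ENNReal.ofReal_pow (norm_nonneg _), ofReal_norm]
    exact ENNReal.rpow_natCast _ 2
  have h1 := ENNReal.lintegral_mul_le_Lp_mul_Lq μ Real.HolderConjugate.two_two
    (f := S.indicator fun _ => 1) (g := fun x => ‖G x‖ₑ)
    (aemeasurable_const.indicator₀ hS) hG.aestronglyMeasurable.enorm
  have h2 : ∀ x, S.indicator (fun _ => (1 : ENNReal)) x ^ (2 : ℝ) = S.indicator (fun _ => 1) x := by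
    intro x
    by_cases hx : x ∈ S <;> simp [hx]
  simp_rw [h2] at h1
  rw [lintegral_indicator_const₀ hS, one_mul, hsq,
    ENNReal.ofReal_rpow_of_nonneg (integral_nonneg fun x => sq_nonneg _) (by norm_num),
    ← Real.sqrt_eq_rpow] at h1
  refine le_trans (lintegral_mono fun x => ?_) h1
  by_cases hx : x ∈ S <;> simp [hx]

end Truncation

/-! ### The inequality for `u` in `H¹`. -/

theorem lemma4p1 {d : ℕ} (hd : 0 < d) (R : ℝ) (hR : 0 < R)
    (u : EuclideanSpace ℝ (Fin d) → ℝ)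
    (hu : MemH1 u (Metric.ball (0 : EuclideanSpace ℝ (Fin d)) R))
    (k l : ℝ) (hkl : k ≤ l) :
    MemH1 (fun x => max (u x - k) 0) (Metric.ball (0 : EuclideanSpace ℝ (Fin d)) R) ∧
    ∀ G : EuclideanSpace ℝ (Fin d) → EuclideanSpace ℝ (Fin d),
      HasWeakGradientOn (fun x => max (u x - k) 0) G
          (Metric.ball (0 : EuclideanSpace ℝ (Fin d)) R) →
        (l - k) *
            volume.real ({x | u x ≤ k} ∩ Metric.ball (0 : EuclideanSpace ℝ (Fin d)) R) *
            volume.real ({x | l ≤ u x} ∩ Metric.ball (0 : EuclideanSpace ℝ (Fin d)) R) ≤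
          R * volume.real (Metric.ball (0 : EuclideanSpace ℝ (Fin d)) R) *
            volume.real
              ({x | k < u x ∧ u x < l} ∩ Metric.ball (0 : EuclideanSpace ℝ (Fin d)) R)
                ^ (1 / 2 : ℝ) *
            Real.sqrt
              (∫ x in Metric.ball (0 : EuclideanSpace ℝ (Fin d)) R, ‖G x‖ ^ 2) := by
  have hmem := hu.max_sub_zero k
  refine ⟨hmem, fun G hG => ?_⟩
  rcases hkl.eq_or_lt with rfl | hlt
  · rw [sub_self, zero_mul, zero_mul]
    positivity
  set B := Metric.ball (0 : EuclideanSpace ℝ (Fin d)) R with hB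
  have hBfin : volume B ≠ ⊤ := measure_ball_lt_top.ne
  have hfin : IsFiniteMeasure (volume.restrict B) := ⟨by simpa using measure_ball_lt_top⟩
  obtain ⟨-, G₀, hG₀, hG₀2⟩ := hmem
  -- An arbitrary weak gradient is only locally integrable by definition; uniqueness identifies it
  -- almost everywhere with a square-integrable one.
  have hG2 : MemLp G 2 (volume.restrict B) :=
    hG₀2.ae_eq (hG₀.ae_eq Metric.isOpen_ball hG)
  have hkey := hG.mul_measure_level_sets_le hd (hG2.integrable one_le_two) (sub_pos.2 hlt)
  have hs1 : {x | max (u x - k) 0 ≤ 0} = {x | u x ≤ k} := by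
    ext x
    simp
  have hs2 : {x | l - k ≤ max (u x - k) 0} = {x | l ≤ u x} := by
    ext x
    simp only [Set.mem_ofPred_eq, le_max_iff, sub_le_sub_iff_right, or_iff_left_iff_imp]
    intro h
    linarith
  have hs3 : {x | 0 < max (u x - k) 0 ∧ max (u x - k) 0 < l - k} = {x | k < u x ∧ u x < l} := by
    ext x
    simp only [Set.mem_ofPred_eq, lt_max_iff, max_lt_iff, sub_pos, lt_irrefl, or_false,
      sub_lt_sub_iff_right, hlt, and_true]
  rw [hs1, hs2, hs3] at hkey
  have hum : AEMeasurable u (volume.restrict B) := hu.1.aestronglyMeasurable.aemeasurable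
  have hS : NullMeasurableSet {x | k < u x ∧ u x < l} (volume.restrict B) :=
    hum.nullMeasurableSet_preimage measurableSet_Ioo
  have hbound := hkey.trans (mul_le_mul_right (lintegral_indicator_enorm_le hG2 hS) _)
  rw [Measure.restrict_apply' Metric.isOpen_ball.measurableSet] at hbound
  have hSfin : volume ({x | k < u x ∧ u x < l} ∩ B) ≠ ⊤ :=
    measure_ne_top_of_subset Set.inter_subset_right hBfin
  -- Finiteness of the right-hand side is essential here, since `toReal` sends `⊤` to `0`.
  have hreal := ENNReal.toReal_mono (by finiteness) hbound
  simp only [ENNReal.toReal_mul, ENNReal.toReal_ofReal (sub_pos.2 hlt).le,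
    ENNReal.toReal_ofReal hR.le, ENNReal.toReal_ofReal (Real.sqrt_nonneg _),
    ← ENNReal.toReal_rpow] at hreal
  rw [← mul_assoc] at hreal
  exact hreal
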